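/- Let $D$ be a diagram in the plane of a (nonempty) classical link. For an abelian group $A$, let $\mathcal{D}_A(D)$ be the group of Dehn colorings of $D$: the functions $d$ from the set of complementary regions of $D$ to $A$ such that at each crossing $d(R)+d(S)=d(T)+d(U)$, where $\{R,S\}$ and $\{T,U\}$ are the pairs of incident regions that are neighbors across the overcrossing arc. Let $\sigma$ be a checkerboard shading of $D$, with unshaded regions $U_1,\dots,U_m$, and let $\eta(c)=\pm1$ be the Goeritz index of a crossing $c$; here $\eta(c)=1$ if, when the diagram is rotated so that the two shaded corners at $c$ are those above and below $c$, the overcrossing arc runs from the lower left to the upper right, and $\eta(c)=-1$ otherwise. The Goeritz matrix $G$ of $(D,\sigma)$ is the $m\times m$ matrix with $G_{ij}=-\sum_c\eta(c)$ for $i\ne j$, the sum being over the crossings incident on both $U_i$ and $U_j$, and $G_{ii}=-\sum_{k\ne i}G_{ik}$. The adjusted Goeritz matrix $G^{adj}(D,\sigma)$ is $\begin{pmatrix}G&0\\0&0\end{pmatrix}$ with $\beta_s-1$ additional rows and columns of zeroes, where $\beta_s$ is the number of connected components of the graph that has a vertex for each shaded region and, for each crossing, an edge joining the shaded regions that appear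 there. Let $n=m+\beta_s-1$ be its size, and let $\phi_j=\delta_j/\delta_{j+1}$ for $0\le j\le n-1$ be its invariant factors, where $\delta_j\ge0$ is the greatest common divisor of the minors of size $n-j$ (the minor of size $0$ being $1$) and $0/0=0$. Then $n\ge1$ and $\phi_0=0$, and there is a connected sum of torus links \[ T=T_{(2,\phi_1)}\,\#\,\cdots\,\#\,T_{(2,\phi_{n-1})} \] such that $\mathcal{D}_A(D)\cong\mathcal{D}_A(D_T)$ for every abelian group $A$ and every diagram $D_T$ of $T$. Here $T_{(2,k)}$, $k\ge0$, is the closure of the braid on two strands with $k$ positive crossings (so $T_{(2,0)}$ is the unlink of two components), a connected sum of links may depend on the components along which it is formed, and for $n=1$ the empty connected sum $T$ is the trivial knot. -/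

import Mathlib

/-! ## Elementary ideals and invariant factors -/

namespace Matrix

/-- The elementary ideal `E_j(M)`: it is generated by the minors of `M` of size `κ - j`, where `κ` is
the number of columns. If `κ ≤ j` this is the unit ideal (the minor of size `0` is `1`), and if
`κ - j` is larger than the number of rows there are no such minors and this is the zero ideal. -/
def elementaryIdeal {m n R : Type*} [Fintype n] [CommRing R] (M : Matrix m n R) (j : ℕ) :
    Ideal R :=
  Ideal.span {x : R | ∃ (r : Fin (Fintype.card n - j) ↪ m) (c : Fin (Fintype.card n - j) ↪ n),
    (M.submatrix r c).det = x}

/-- `δ_j(M)`: the non-negative greatest common divisor of the `j`-th elementary ideal of an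
integer matrix. -/
noncomputable def elementaryGcd {m n : Type*} [Fintype n] (M : Matrix m n ℤ) (j : ℕ) : ℕ :=
  (Submodule.IsPrincipal.generator (M.elementaryIdeal j)).natAbs

/-- The invariant factor `φ_j(M) = δ_j(M) / δ_{j+1}(M)` (with `0 / 0 = 0`), meant for
`0 ≤ j < κ`. -/
noncomputable def invariantFactor {m n : Type*} [Fintype n] (M : Matrix m n ℤ) (j : ℕ) : ℕ :=
  M.elementaryGcd j / M.elementaryGcd (j + 1)

end Matrix

namespace ClassicalLink

/-! ## Link diagrams

A link diagram in the plane, in general position with respect to the height function, is cut by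
horizontal level lines into slices, each of which contains exactly one minimum (`cup`), maximum
(`cap`) or crossing, all other strands being vertical. The diagram is recorded as the list of these
events, from bottom to top. At every level the strands are numbered `0, 1, 2, …` from left to right,
and the gap `g` is the interval of the level line to the left of strand `g` (and to the right of
strand `g - 1`). -/

/-- The kinds of events. At `cross true` the strand that runs from the lower left to the upper right
is the overcrossing one, at `cross false` the strand that runs from the lower right to the upper
left is. -/
inductive EventKind : Type
  | cup : EventKind
  | cap : EventKind
  | cross : Bool → EventKind

/-- The number of strands that enter an event from below. -/
def EventKind.src : EventKind → ℕ
  | cup => 0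
  | cap => 2
  | cross _ => 2

/-- The number of strands that leave an event upwards. -/
def EventKind.tgt : EventKind → ℕ
  | cup => 2
  | cap => 0
  | cross _ => 2

/-- An event that has exactly `pos` vertical strands to its left. -/
structure Event : Type where
  kind : EventKind
  pos : ℕ

/-- A minimum, whose two legs become the strands `i` and `i + 1` of the level above. -/
def cup (i : ℕ) : Event := ⟨.cup, i⟩

/-- A maximum, which joins the strands `i` and `i + 1` of the level below. -/
def cap (i : ℕ) : Event := ⟨.cap, i⟩

/-- A crossing of the strands `i` and `i + 1`. -/
def cross (i : ℕ) (b : Bool) : Event := ⟨.cross b, i⟩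

/-- The event can be placed above a level with `n` strands. -/
def Event.Fits (e : Event) (n : ℕ) : Prop := e.pos + e.kind.src ≤ n

/-- The number of strands above an event that has `n` strands below it. -/
def Event.out (e : Event) (n : ℕ) : ℕ := n - e.kind.src + e.kind.tgt

/-- Inside the slice of the event `e`, the gap `g` of the level below and the gap `h` of the level
above belong to the same component of the complement of the diagram: they lie both to the left of
the event, or both to its right. (The left and the right side of a minimum are joined with each
other through the gap below it, and those of a maximum through the gap above it.) -/
def Event.Joins (e : Event) (g h : ℕ) : Prop :=
  (g ≤ e.pos ∧ h = g) ∨ (e.pos + e.kind.src ≤ g ∧ h + e.kind.src = g + e.kind.tgt)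

/-- The list of events is a tangle diagram with `n` strands at the bottom and `m` at the top. -/
def IsTangle : List Event → ℕ → ℕ → Prop
  | [], n, m => n = m
  | e :: w, n, m => e.Fits n ∧ IsTangle w (e.out n) m

/-- Diagrams of (nonempty, unoriented) classical links. -/
structure LinkDiagram : Type where
  word : List Event
  closed : IsTangle word 0 0
  nonempty : word ≠ []

theorem IsTangle.fits_getElem {w : List Event} {n m : ℕ} (hw : IsTangle w n m) {k : ℕ}
    {e : Event} (h : w[k]? = some e) :
    e.Fits ((w.take k).foldl (fun a f => f.out a) n) := by
  induction w generalizing n k with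
  | nil => simp at h
  | cons f w ih =>
    cases k with
    | zero =>
      simp only [List.getElem?_cons_zero, Option.some.injEq] at h
      subst h
      simpa using hw.1
    | succ k =>
      simp only [List.getElem?_cons_succ] at h
      simpa using ih hw.2 h

namespace LinkDiagram

variable (D : LinkDiagram)

/-- The number of strands at level `k`, i.e. above the first `k` events. -/
def width (k : ℕ) : ℕ := (D.word.take k).foldl (fun n e => e.out n) 0

theorem width_succ {k : ℕ} {e : Event} (h : D.word[k]? = some e) :
    D.width (k + 1) = e.out (D.width k) := by
  simp [width, List.take_add_one, h, List.foldl_append]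

/-! ### Regions -/

/-- The gaps `(k, g)`: level `k`, gap number `g`. -/
def Gap : Type := {p : ℕ × ℕ // p.1 ≤ D.word.length ∧ p.2 ≤ D.width p.1}

/-- The gap `p` and the gap `q` of the next level are joined inside the slice between them. -/
def GapJoined (p q : D.Gap) : Prop :=
  ∃ e : Event, D.word[p.1.1]? = some e ∧ q.1.1 = p.1.1 + 1 ∧ e.Joins p.1.2 q.1.2

/-- The complementary regions of the diagram in the plane: the classes of gaps under the equivalence
relation generated by being joined inside a slice. -/
def Region : Type := Quot D.GapJoined

/-- The region that contains the gap `g` of level `k`. -/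
def region (k g : ℕ) (hk : k ≤ D.word.length) (hg : g ≤ D.width k) : D.Region :=
  Quot.mk _ ⟨(k, g), hk, hg⟩

instance : Finite D.Gap := by
  refine Set.Finite.to_subtype (s := {p : ℕ × ℕ | p.1 ≤ D.word.length ∧ p.2 ≤ D.width p.1}) ?_
  refine Set.Finite.subset (Set.Finite.biUnion (Set.finite_Iic D.word.length)
    (fun k _ => (Set.finite_Iic (D.width k)).image (fun g => (k, g)))) ?_
  rintro ⟨k, g⟩ ⟨hk, hg⟩
  simp only [Set.mem_iUnion]
  exact ⟨k, hk, g, hg, rfl⟩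

instance : Finite D.Region := inferInstanceAs (Finite (Quot D.GapJoined))

/-! ### Crossings -/

/-- The crossings of the diagram; `risingOver` tells whether the overcrossing arc is the one that
runs from the lower left to the upper right. -/
structure Crossing : Type where
  level : ℕ
  pos : ℕ
  risingOver : Bool
  spec : D.word[level]? = some (cross pos risingOver)

instance : Finite D.Crossing := by
  refine Finite.of_injective
    (fun c : D.Crossing => (⟨c.level, (List.getElem?_eq_some_iff.1 c.spec).1⟩ :
      Fin D.word.length)) ?_
  rintro ⟨k, i, b, h⟩ ⟨l, j, c, h'⟩ hkl
  simp only [Fin.mk.injEq] at hkl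
  subst hkl
  rw [h] at h'
  simp only [cross, Option.some.injEq, Event.mk.injEq, EventKind.cross.injEq] at h'
  obtain ⟨rfl, rfl⟩ := h'
  rfl

noncomputable instance : Fintype D.Crossing := Fintype.ofFinite _

variable {D}

namespace Crossing

variable (c : D.Crossing)

theorem level_lt : c.level < D.word.length := (List.getElem?_eq_some_iff.1 c.spec).1

theorem pos_le : c.pos + 2 ≤ D.width c.level := D.closed.fits_getElem c.spec

theorem pos_le_succ : c.pos + 2 ≤ D.width (c.level + 1) := by
  have h := c.pos_le
  rw [D.width_succ c.spec]
  simp only [cross, Event.out, EventKind.src, EventKind.tgt]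
  omega

/-- The four regions that are incident at a crossing. -/
def left : D.Region :=
  D.region c.level c.pos c.level_lt.le (by have := c.pos_le; omega)

def right : D.Region :=
  D.region c.level (c.pos + 2) c.level_lt.le c.pos_le

def bottom : D.Region :=
  D.region c.level (c.pos + 1) c.level_lt.le (by have := c.pos_le; omega)

def top : D.Region :=
  D.region (c.level + 1) (c.pos + 1) c.level_lt (by have := c.pos_le_succ; omega)

/-- The region `R` is incident at the crossing. -/
def Incident (R : D.Region) : Prop := R = c.left ∨ R = c.right ∨ R = c.bottom ∨ R = c.top

end Crossing

/-! ### Dehn colorings -/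

variable (D)

/-- The group of Dehn colorings: at each crossing, the two regions `R`, `S` that are neighbors across
one half of the overcrossing arc and the two regions `T`, `U` that are neighbors across the other
half satisfy `d R + d S = d T + d U`. If the overcrossing arc runs from the lower left to the upper
right, these pairs are `{top, right}` and `{left, bottom}`; otherwise they are `{left, top}` and
`{bottom, right}`. -/
def dehnColorings (A : Type*) [AddCommGroup A] : AddSubgroup (D.Region → A) where
  carrier := {d | ∀ c : D.Crossing,
    if c.risingOver then d c.top + d c.right = d c.left + d c.bottom
    else d c.left + d c.top = d c.bottom + d c.right}
  zero_mem' := by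
    intro c
    split_ifs <;> simp
  add_mem' := by
    intro d d' hd hd' c
    have h := hd c
    have h' := hd' c
    split_ifs at h h' ⊢ <;> simp only [Pi.add_apply]
    · rw [add_add_add_comm, h, h', add_add_add_comm]
    · rw [add_add_add_comm, h, h', add_add_add_comm]
  neg_mem' := by
    intro d hd c
    have h := hd c
    split_ifs at h ⊢ <;> simp only [Pi.neg_apply] <;> rw [← neg_add, h, neg_add]

/-! ### Shadings and Goeritz matrices -/

/-- A checkerboard shading: regions on the two sides of an arc of the diagram are shaded
differently. The value `true` means shaded. -/
structure Shading : Type where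
  shaded : D.Region → Bool
  alternate : ∀ (k g : ℕ) (hk : k ≤ D.word.length) (hg : g + 1 ≤ D.width k),
    shaded (D.region k g hk (Nat.le_of_succ_le hg)) ≠ shaded (D.region k (g + 1) hk hg)

variable {D}

namespace Shading

variable (σ : D.Shading)

/-- The unshaded regions. -/
def Unshaded : Type := {R : D.Region // σ.shaded R = false}

/-- The shaded regions. -/
def Shaded : Type := {R : D.Region // σ.shaded R = true}

instance : Finite σ.Unshaded := inferInstanceAs (Finite {R : D.Region // σ.shaded R = false})

noncomputable instance : Fintype σ.Unshaded := Fintype.ofFinite _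

/-- The Goeritz index of a crossing: it is `1` if the overcrossing arc runs from the lower left to
the upper right and the regions below and above the crossing are shaded, and also if it runs from
the lower right to the upper left and the regions to the left and to the right are shaded;
otherwise it is `-1`. -/
def goeritzIndex (c : D.Crossing) : ℤ := if σ.shaded c.bottom = c.risingOver then 1 else -1

open scoped Classical in
/-- The off-diagonal entries of the Goeritz matrix. -/
noncomputable def goeritzEntry (U V : σ.Unshaded) : ℤ :=
  -∑ c : D.Crossing with c.Incident U.1 ∧ c.Incident V.1, σ.goeritzIndex c

open scoped Classical in
/-- The Goeritz matrix, indexed by the unshaded regions. -/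
noncomputable def goeritz : Matrix σ.Unshaded σ.Unshaded ℤ :=
  Matrix.of fun U V =>
    if U = V then -∑ W : σ.Unshaded with W ≠ U, σ.goeritzEntry U W else σ.goeritzEntry U V

/-- The shaded checkerboard graph, without loops and multiplicities of edges, which have no
influence on its connected components. -/
def shadedGraph : SimpleGraph σ.Shaded :=
  SimpleGraph.fromRel fun R S => ∃ c : D.Crossing, c.Incident R.1 ∧ c.Incident S.1

/-- The number `β_s` of connected components of the shaded checkerboard graph. -/
noncomputable def beta : ℕ := Nat.card σ.shadedGraph.ConnectedComponent

/-- The adjusted Goeritz matrix: the Goeritz matrix with `β_s - 1` additional rows and columns of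
zeroes. -/
noncomputable def adjustedGoeritz :
    Matrix (σ.Unshaded ⊕ Fin (σ.beta - 1)) (σ.Unshaded ⊕ Fin (σ.beta - 1)) ℤ :=
  Matrix.fromBlocks σ.goeritz 0 0 0

/-- The size of the adjusted Goeritz matrix, i.e. the number of its invariant factors. -/
noncomputable def order : ℕ := Fintype.card (σ.Unshaded ⊕ Fin (σ.beta - 1))

end Shading

end LinkDiagram

/-! ## Links

Two diagrams represent the same link if and only if they differ by planar isotopies and
Reidemeister moves. -/

/-- The local moves between tangle diagrams that are cut into slices: the planar isotopies
`far`, `zigzag_left`, `zigzag_right`, `slide_cup`, `slide_cap` and the three Reidemeister moves. -/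
inductive LocalMove : List Event → List Event → Prop
  /-- Two distant events exchange their heights. -/
  | far (a b : EventKind) (i k : ℕ) :
      LocalMove [⟨a, i⟩, ⟨b, i + a.tgt + k⟩] [⟨b, i + a.src + k⟩, ⟨a, i⟩]
  /-- A neighboring minimum and maximum of a strand cancel. -/
  | zigzag_left (i : ℕ) : LocalMove [cup (i + 1), cap i] []
  | zigzag_right (i : ℕ) : LocalMove [cup i, cap (i + 1)] []
  /-- A crossing passes a minimum or a maximum of one of its two strands. -/
  | slide_cup (i : ℕ) (b : Bool) :
      LocalMove [cup i, cross (i + 1) b] [cup (i + 1), cross i (!b)]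
  | slide_cap (i : ℕ) (b : Bool) :
      LocalMove [cross (i + 1) b, cap i] [cross i (!b), cap (i + 1)]
  /-- First Reidemeister move, at a minimum or at a maximum. -/
  | reidemeister_one_cup (i : ℕ) (b : Bool) : LocalMove [cup i, cross i b] [cup i]
  | reidemeister_one_cap (i : ℕ) (b : Bool) : LocalMove [cross i b, cap i] [cap i]
  /-- Second Reidemeister move. -/
  | reidemeister_two (i : ℕ) (b : Bool) : LocalMove [cross i b, cross i (!b)] []
  /-- Third Reidemeister move. The condition says that one of the three strands lies above the
  other two, and one lies below the other two. -/
  | reidemeister_three (i : ℕ) (a b c : Bool) (h : b = a ∨ b = c) :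
      LocalMove [cross i a, cross (i + 1) b, cross i c]
        [cross (i + 1) c, cross i b, cross (i + 1) a]

/-- The diagrams differ by one local move. -/
def LinkDiagram.Move (D E : LinkDiagram) : Prop :=
  ∃ u v s t : List Event, LocalMove s t ∧ D.word = u ++ s ++ v ∧ E.word = u ++ t ++ v

/-- Classical (unoriented, nonempty) link types: classes of diagrams under the equivalence relation
generated by the moves. -/
def Link : Type := Quot LinkDiagram.Move

/-- The link that is represented by a diagram. -/
def LinkDiagram.link (D : LinkDiagram) : Link := Quot.mk _ D

/-- `D` is a diagram of the link `L`. -/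
def LinkDiagram.IsDiagramOf (D : LinkDiagram) (L : Link) : Prop := D.link = L

/-! ### Tangles, closures and connected sums -/

theorem IsTangle.append {u v : List Event} {n m p : ℕ} (hu : IsTangle u n m)
    (hv : IsTangle v m p) : IsTangle (u ++ v) n p := by
  induction u generalizing n with
  | nil => exact (show n = m from hu) ▸ hv
  | cons e u ih => exact ⟨hu.1, ih hu.2⟩

/-- A tangle diagram with one vertical strand added on its right. -/
theorem IsTangle.add_strand {u : List Event} {n m : ℕ} (hu : IsTangle u n m) :
    IsTangle u (n + 1) (m + 1) := by
  induction u generalizing n with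
  | nil => exact congrArg (· + 1) (show n = m from hu)
  | cons e u ih =>
    have h1 : e.pos + e.kind.src ≤ n := hu.1
    refine ⟨Nat.le_succ_of_le h1, ?_⟩
    have h2 : e.out (n + 1) = e.out n + 1 := by
      simp only [Event.out]
      omega
    rw [h2]
    exact ih hu.2

/-- The closure of a tangle with one strand at the bottom and one at the top: its two ends are joined
by an arc that runs on its right. -/
def closure (t : List Event) (ht : IsTangle t 1 1) : LinkDiagram where
  word := [cup 0] ++ t ++ [cap 0]
  closed := by
    refine IsTangle.append (m := 2) (IsTangle.append (m := 2) ?_ ht.add_strand) ?_ <;>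
      simp [IsTangle, Event.Fits, Event.out, cup, cap, EventKind.src, EventKind.tgt]
  nonempty := by simp

/-- The trivial knot. -/
def unknot : Link := (closure [] rfl).link

/-- `L` is a connected sum of `L₁` and `L₂`: these are the closures of tangles with one strand at the
bottom and one at the top, and `L` is the closure of the composition of the tangles. A connected sum
of links depends on the components that are joined, so it is a relation. -/
def IsConnectedSum (L₁ L₂ L : Link) : Prop :=
  ∃ (t₁ t₂ : List Event) (h₁ : IsTangle t₁ 1 1) (h₂ : IsTangle t₂ 1 1),
    (closure t₁ h₁).link = L₁ ∧ (closure t₂ h₂).link = L₂ ∧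
      (closure (t₁ ++ t₂) (h₁.append h₂)).link = L

/-- `IsIteratedConnectedSum [L₁, …, Lₘ] L` says that `L` is a connected sum `L₁ # (L₂ # (⋯ # Lₘ))`.
The connected sum of no links is the trivial knot, which is neutral for connected sums. -/
inductive IsIteratedConnectedSum : List Link → Link → Prop
  | nil : IsIteratedConnectedSum [] unknot
  | cons {L K M : Link} {Ls : List Link} (hK : IsIteratedConnectedSum Ls K)
      (hM : IsConnectedSum L K M) : IsIteratedConnectedSum (L :: Ls) M

/-! ### Torus links -/

theorem isTangle_replicate_cross (k : ℕ) (b : Bool) :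
    IsTangle (List.replicate k (cross 0 b)) 4 4 := by
  induction k with
  | zero => rfl
  | succ k ih => exact ⟨by simp [Event.Fits, cross, EventKind.src], ih⟩

/-- The standard diagram of the torus link `T_(2,k)`, `k ≥ 0`: the closure of the braid on two
strands with `k` crossings, which are positive for parallel orientations of the strands. -/
def torusDiagram (k : ℕ) : LinkDiagram where
  word := [cup 0, cup 1] ++ List.replicate k (cross 0 true) ++ [cap 1, cap 0]
  closed := by
    refine IsTangle.append (m := 4) (IsTangle.append (m := 4) ?_
      (isTangle_replicate_cross k true)) ?_ <;>
      simp [IsTangle, Event.Fits, Event.out, cup, cap, EventKind.src, EventKind.tgt]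
  nonempty := by simp

/-- The torus link `T_(2,k)`. -/
def torusLink (k : ℕ) : Link := (torusDiagram k).link

end ClassicalLink

/-! Fix a checkerboard shading. At a crossing, the Dehn condition says that the difference of the
two shaded corners is, up to a sign recorded by the Goeritz index, the difference of the two
unshaded corners. The colors of the unshaded regions therefore prescribe the differences of the
shaded colors. By planarity, shaded colors with these differences exist exactly when the prescribed
differences sum to zero around every unshaded region, and this is the Goeritz system. The shaded
colors are then determined up to one constant on each component of the shaded graph. Hence the Dehn
colorings form `A ^ β_s × ker G`, which is `A × ker G^adj`, the `β_s - 1` zero rows and columns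
absorbing all constants but one (`nonempty_dehnColorings_addEquiv_prod`).

By the Smith normal form, `ker G^adj` is the product of the `φ_j`-torsion subgroups of `A`. The rows
of `G` sum to zero, so `φ_0 = 0` and its factor is `A` itself. The result is `A × A` times the
product of the `φ_j`-torsion for `j ≥ 1`.

On the side of the torus links, a coloring is read from bottom to top. In the tangle of `T_(2,k)`
every crossing adds the same difference to one gap, and closing up forces `k` times this difference
to vanish; so each summand contributes the `k`-torsion of `A`, and the closing arc leaves two free
colors (`nonempty_dehnColorings_torusSum_addEquiv`). Any other diagram of the same link gives an
isomorphic group, because a local move preserves the boundary colorings that extend over it and the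
extensions are unique on both of its sides (`LocalMove.reach_iff`, `LocalMove.rigid`).

Planarity enters twice, each time by comparing sums along successive horizontal levels. Necessity of
the Goeritz equations is a discrete Stokes formula (`sum_crossingPairing_eq_zero`). For sufficiency,
the Goeritz equations provide a flow inside the regions, and its amount to the left of a shaded gap
is the required potential (`exists_gap_potential`). -/

namespace Matrix

/-! ### Ideals of minors, and the invariant factors of a diagonal matrix. -/

section MinorIdeals

variable {l m n o R : Type*} [CommRing R]

/-- The rows of `P * M` are combinations of rows of `M`, so expanding the determinant multilinearly
in its rows gives a combination of minors of `M`; choices that repeat a row contribute zero. -/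
theorem det_submatrix_mul_mem [Fintype m] [Fintype n] (P : Matrix l m R) (M : Matrix m n R) (j : ℕ)
    (r : Fin (Fintype.card n - j) ↪ l) (c : Fin (Fintype.card n - j) ↪ n) :
    ((P * M).submatrix r c).det ∈ M.elementaryIdeal j := by
  classical
  have h : (P * M).submatrix r c = fun i => ∑ a, P (r i) a • fun k => M a (c k) := by
    ext i k
    simp [Matrix.mul_apply, Finset.sum_apply]
  have h2 : ((P * M).submatrix r c).det =
      ∑ f : Fin (Fintype.card n - j) → m, (∏ i, P (r i) (f i)) • (M.submatrix f c).det := by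
    rw [h]
    change detRowAlternating.toMultilinearMap _ = _
    rw [MultilinearMap.map_sum]
    refine Finset.sum_congr rfl fun f _ => ?_
    rw [MultilinearMap.map_smul_univ]
    rfl
  rw [h2]
  refine Ideal.sum_mem _ fun f _ => ?_
  by_cases hf : Function.Injective f
  · exact Ideal.mul_mem_left _ _ (Ideal.subset_span ⟨⟨f, hf⟩, c, rfl⟩)
  · rw [Function.not_injective_iff] at hf
    obtain ⟨a, b, hab, hne⟩ := hf
    rw [det_zero_of_row_eq hne (by ext k; simp [hab]), smul_zero]
    exact Ideal.zero_mem _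

theorem elementaryIdeal_mul_le_right [Fintype m] [Fintype n] (P : Matrix l m R) (M : Matrix m n R)
    (j : ℕ) : (P * M).elementaryIdeal j ≤ M.elementaryIdeal j := by
  refine Ideal.span_le.2 ?_
  rintro x ⟨r, c, rfl⟩
  exact det_submatrix_mul_mem P M j r c

theorem elementaryIdeal_transpose [Fintype n] (M : Matrix n n R) (j : ℕ) :
    Mᵀ.elementaryIdeal j = M.elementaryIdeal j := by
  unfold elementaryIdeal
  congr 1
  ext x
  constructor
  · rintro ⟨r, c, rfl⟩
    exact ⟨c, r, by rw [← det_transpose]; rfl⟩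
  · rintro ⟨r, c, rfl⟩
    exact ⟨c, r, by rw [← det_transpose]; rfl⟩

theorem elementaryIdeal_mul_le_left [Fintype n] (M Q : Matrix n n R) (j : ℕ) :
    (M * Q).elementaryIdeal j ≤ M.elementaryIdeal j := by
  rw [← elementaryIdeal_transpose, transpose_mul, ← elementaryIdeal_transpose M]
  exact elementaryIdeal_mul_le_right _ _ _

theorem elementaryIdeal_submatrix_equiv [Fintype m] [Fintype n] (M : Matrix m m R) (e : n ≃ m)
    (j : ℕ) : (M.submatrix e e).elementaryIdeal j = M.elementaryIdeal j := by
  have hc : Fintype.card n = Fintype.card m := Fintype.card_congr e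
  unfold elementaryIdeal
  congr 1
  ext x
  rw [hc]
  constructor
  · rintro ⟨r, c, rfl⟩
    exact ⟨r.trans e.toEmbedding, c.trans e.toEmbedding, rfl⟩
  · rintro ⟨r, c, rfl⟩
    exact ⟨r.trans e.symm.toEmbedding, c.trans e.symm.toEmbedding, by
      congr 1; ext; simp⟩

theorem elementaryIdeal_unit_mul_unit [Fintype n] [DecidableEq n] (P M Q : Matrix n n R)
    (hP : IsUnit P) (hQ : IsUnit Q) (j : ℕ) :
    (P * M * Q).elementaryIdeal j = M.elementaryIdeal j := by
  refine le_antisymm ((elementaryIdeal_mul_le_left _ _ _).trans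
    (elementaryIdeal_mul_le_right _ _ _)) ?_
  obtain ⟨p, rfl⟩ := hP
  obtain ⟨q, rfl⟩ := hQ
  have h : M = (↑p⁻¹ : Matrix n n R) * (p * M * q) * (↑q⁻¹ : Matrix n n R) := by
    simp [mul_assoc]
  conv_lhs => rw [h]
  exact (elementaryIdeal_mul_le_left _ _ _).trans (elementaryIdeal_mul_le_right _ _ _)

end MinorIdeals

/-- After sorting the chosen indices, the `i`-th smallest of them is at least `i`, so the
divisibility holds factor by factor. -/
theorem _root_.Fin.prod_castLE_dvd_prod {R : Type*} [CommMonoid R] {k n : ℕ} (hk : k ≤ n)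
    (d : Fin n → R) (hd : ∀ i j, i ≤ j → d i ∣ d j) (c : Fin k ↪ Fin n) :
    ∏ i, d (Fin.castLE hk i) ∣ ∏ i, d (c i) := by
  classical
  have hs : (Finset.univ.map c).card = k := by simp
  have h1 : ∏ i, d (c i) = ∏ i : Fin k, d ((Finset.univ.map c).orderEmbOfFin hs i) := by
    rw [← Finset.prod_map Finset.univ c d]
    conv_lhs => rw [← Finset.map_orderEmbOfFin_univ _ hs, Finset.prod_map]
    rfl
  rw [h1]
  refine Finset.prod_dvd_prod_of_dvd _ _ fun i _ => hd _ _ ?_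
  rw [Fin.le_def]
  have hm : StrictMono fun i : Fin k => (((Finset.univ.map c).orderEmbOfFin hs i : Fin n) : ℕ) :=
    fun a b hab => ((Finset.univ.map c).orderEmbOfFin hs).strictMono hab
  obtain ⟨i, hi⟩ := i
  induction i with
  | zero => simp
  | succ i ih =>
    have := ih (by omega)
    have h3 := @hm ⟨i, by omega⟩ ⟨i + 1, hi⟩ (by simp [Fin.lt_def])
    simp only [Fin.val_castLE] at this h3 ⊢
    exact lt_of_le_of_lt (this (Finset.mem_univ _)) h3

/-- Every Leibniz term of a minor is zero or a product of entries over the chosen columns, hence a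
multiple of the product of the first `n - j` entries. The leading principal minor is this product.
-/
theorem elementaryIdeal_diagonal {R : Type*} [CommRing R] {n : ℕ} (d : Fin n → R)
    (hd : ∀ i j, i ≤ j → d i ∣ d j) (j : ℕ) :
    (diagonal d).elementaryIdeal j =
      Ideal.span {∏ i : Fin (n - j), d (Fin.castLE (Nat.sub_le n j) i)} := by
  unfold elementaryIdeal
  rw [Fintype.card_fin]
  refine le_antisymm (Ideal.span_le.2 ?_) (Ideal.span_mono ?_)
  · rintro x ⟨r, c, rfl⟩
    rw [SetLike.mem_coe, Ideal.mem_span_singleton, det_apply]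
    refine Finset.dvd_sum fun s _ => ?_
    refine Dvd.dvd.trans (Fin.prod_castLE_dvd_prod (Nat.sub_le n j) d hd c) ?_
    rw [Units.smul_def, zsmul_eq_mul]
    refine Dvd.dvd.mul_left ?_ _
    refine Finset.prod_dvd_prod_of_dvd _ _ fun i _ => ?_
    rw [submatrix_apply, diagonal_apply]
    split_ifs with h
    · rw [h]
    · exact dvd_zero _
  · rintro x rfl
    refine ⟨Fin.castLEEmb (Nat.sub_le n j), Fin.castLEEmb (Nat.sub_le n j), ?_⟩
    rw [submatrix_diagonal_embedding, det_diagonal]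
    rfl

theorem elementaryGcd_eq_of_ideal {m n : Type*} [Fintype n] (M : Matrix m n ℤ) (j : ℕ) (a : ℤ)
    (h : M.elementaryIdeal j = Ideal.span {a}) : M.elementaryGcd j = a.natAbs := by
  unfold elementaryGcd
  refine Int.natAbs_eq_iff_associated.2 ?_
  rw [← Ideal.span_singleton_eq_span_singleton, Ideal.span_singleton_generator, h]

theorem invariantFactor_diagonal {n : ℕ} (d : Fin n → ℤ)
    (hd : ∀ i j, i ≤ j → d i ∣ d j) (j : ℕ) (hj : j < n) :
    (diagonal d).invariantFactor j = (d ⟨n - 1 - j, by omega⟩).natAbs := by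
  unfold invariantFactor
  rw [elementaryGcd_eq_of_ideal _ _ _ (elementaryIdeal_diagonal d hd j),
    elementaryGcd_eq_of_ideal _ _ _ (elementaryIdeal_diagonal d hd (j + 1))]
  obtain ⟨k, rfl⟩ : ∃ k, n = k + 1 + j := ⟨n - 1 - j, by omega⟩
  have e1 : ∏ i : Fin (k + 1 + j - j), d (Fin.castLE (Nat.sub_le _ _) i) =
      ∏ i : Fin (k + 1), d (Fin.castLE (by omega) i) :=
    Fintype.prod_equiv (finCongr (by omega)) _ _ fun i => rfl
  have e2 : ∏ i : Fin (k + 1 + j - (j + 1)), d (Fin.castLE (Nat.sub_le _ _) i) =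
      ∏ i : Fin k, d (Fin.castLE (by omega) i) :=
    Fintype.prod_equiv (finCongr (by omega)) _ _ fun i => rfl
  have e3 : (⟨k + 1 + j - 1 - j, by omega⟩ : Fin (k + 1 + j)) =
      Fin.castLE (by omega) (Fin.last k) := by
    ext
    simp
  rw [e1, e2, e3, Fin.prod_univ_castSucc, Int.natAbs_mul]
  have e4 : ∏ i : Fin k, d (Fin.castLE (by omega : k + 1 ≤ k + 1 + j) i.castSucc) =
      ∏ i : Fin k, d (Fin.castLE (by omega) i) := rfl
  rw [e4]
  -- If the shorter product vanishes, the quotient is `0` by convention. This is the correct value,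
  -- since an entry `0` of the chain divides all later ones.
  rcases Nat.eq_zero_or_pos (∏ i : Fin k, d (Fin.castLE (by omega) i)).natAbs with h0 | h0
  · rw [h0, zero_mul, Nat.zero_div]
    rw [Int.natAbs_eq_zero, Finset.prod_eq_zero_iff] at h0
    obtain ⟨i, -, hi⟩ := h0
    have h := hd (Fin.castLE (by omega) i) (Fin.castLE (by omega) (Fin.last k))
      (by rw [Fin.le_def]; simp)
    rw [hi, zero_dvd_iff] at h
    rw [h]
    rfl
  · exact Nat.mul_div_cancel_left _ h0

/-! ### Smith normal form of square integer matrices -/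

/-- `N` arises from `M` by multiplication with invertible matrices from both sides. -/
def UnitEquivalent {n : Type*} [Fintype n] [DecidableEq n] (M N : Matrix n n ℤ) : Prop :=
  ∃ P Q : Matrix n n ℤ, IsUnit P ∧ IsUnit Q ∧ N = P * M * Q

namespace UnitEquivalent

variable {m n : Type*} [Fintype n] [DecidableEq n] [Fintype m] [DecidableEq m]

theorem refl (M : Matrix n n ℤ) : UnitEquivalent M M :=
  ⟨1, 1, isUnit_one, isUnit_one, by simp⟩

theorem trans {M N K : Matrix n n ℤ} (h : UnitEquivalent M N) (h' : UnitEquivalent N K) :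
    UnitEquivalent M K := by
  obtain ⟨P, Q, hP, hQ, rfl⟩ := h
  obtain ⟨P', Q', hP', hQ', rfl⟩ := h'
  exact ⟨P' * P, Q * Q', hP'.mul hP, hQ.mul hQ', by simp only [mul_assoc]⟩

theorem transpose {M N : Matrix n n ℤ} (h : UnitEquivalent M N) : UnitEquivalent Mᵀ Nᵀ := by
  obtain ⟨P, Q, hP, hQ, rfl⟩ := h
  refine ⟨Qᵀ, Pᵀ, ?_, ?_, by simp [mul_assoc]⟩
  · rwa [isUnit_iff_isUnit_det, det_transpose, ← isUnit_iff_isUnit_det]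
  · rwa [isUnit_iff_isUnit_det, det_transpose, ← isUnit_iff_isUnit_det]

theorem mul_right (M Q : Matrix n n ℤ) (hQ : Q.det = 1) : UnitEquivalent M (M * Q) :=
  ⟨1, Q, isUnit_one, by rw [isUnit_iff_isUnit_det, hQ]; exact isUnit_one, by simp⟩

theorem mul_left (M P : Matrix n n ℤ) (hP : P.det = 1) : UnitEquivalent M (P * M) :=
  ⟨P, 1, by rw [isUnit_iff_isUnit_det, hP]; exact isUnit_one, isUnit_one, by simp⟩

theorem submatrix_equiv {M N : Matrix n n ℤ} (h : UnitEquivalent M N) (e : m ≃ n) :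
    UnitEquivalent (M.submatrix e e) (N.submatrix e e) := by
  obtain ⟨P, Q, hP, hQ, rfl⟩ := h
  refine ⟨P.submatrix e e, Q.submatrix e e, ?_, ?_, ?_⟩
  · rwa [isUnit_iff_isUnit_det, det_submatrix_equiv_self, ← isUnit_iff_isUnit_det]
  · rwa [isUnit_iff_isUnit_det, det_submatrix_equiv_self, ← isUnit_iff_isUnit_det]
  · simp [submatrix_mul_equiv]

theorem permute (M : Matrix n n ℤ) (e f : Equiv.Perm n) :
    UnitEquivalent M (M.submatrix e f) := by
  have hu : ∀ g : Equiv.Perm n, IsUnit (g.toPEquiv.toMatrix : Matrix n n ℤ) := fun g => by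
    refine (isUnit_iff_isUnit_det _).2 ?_
    rw [show (g.toPEquiv.toMatrix : Matrix n n ℤ) = Equiv.Perm.permMatrix ℤ g from rfl,
      det_permutation]
    exact (Equiv.Perm.sign g).isUnit
  refine ⟨e.toPEquiv.toMatrix, f.symm.toPEquiv.toMatrix, hu e, hu f.symm, ?_⟩
  · ext i j
    simp [PEquiv.toMatrix_toPEquiv_mul, PEquiv.mul_toMatrix_toPEquiv]

/-- A non-zero entry of least absolute value among all equivalent matrices divides the other
entries of its row. -/
theorem dvd_row {M N : Matrix n n ℤ} (h : UnitEquivalent M N) (o : n)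
    (hmin : ∀ K, UnitEquivalent M K → ∀ i j, K i j ≠ 0 → (N o o).natAbs ≤ (K i j).natAbs)
    (h0 : N o o ≠ 0) (j : n) : N o o ∣ N o j := by
  by_cases hj : j = o
  · rw [hj]
  -- This column operation replaces the entry `N o j` by its remainder modulo the pivot, which by
  -- minimality must be zero.
  · have h1 := h.trans (mul_right N (transvection o j (-(N o j / N o o)))
      (det_transvection_of_ne _ _ (Ne.symm hj) _))
    have h2 := hmin _ h1 o j
    rw [mul_transvection_apply_same] at h2
    have h3 : N o j + -(N o j / N o o) * N o o = N o j % N o o := by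
      rw [Int.emod_def]
      ring
    rw [h3] at h2
    by_contra hd
    have h4 := h2 fun h => hd (Int.dvd_of_emod_eq_zero h)
    have h5 := Int.emod_lt_abs (N o j) h0
    have h6 := Int.emod_nonneg (N o j) h0
    rw [Int.abs_eq_natAbs] at h5
    omega

/-- Minimizing over all equivalent matrices at once takes the place of running the Euclidean
algorithm; two swaps bring the minimal entry to the position `(o, o)`. -/
theorem exists_pivot (M : Matrix n n ℤ) (hM : M ≠ 0) (o : n) :
    ∃ N, UnitEquivalent M N ∧ N o o ≠ 0 ∧
      ∀ K, UnitEquivalent M K → ∀ i j, K i j ≠ 0 → (N o o).natAbs ≤ (K i j).natAbs := by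
  classical
  have hex : ∃ k : ℕ, ∃ N, UnitEquivalent M N ∧ ∃ i j, N i j ≠ 0 ∧ (N i j).natAbs = k := by
    by_contra hne
    refine hM (ext fun i j => ?_)
    by_contra h
    exact hne ⟨_, M, refl M, i, j, h, rfl⟩
  obtain ⟨N, hN, i, j, h0, hk⟩ := Nat.find_spec hex
  refine ⟨N.submatrix (Equiv.swap o i) (Equiv.swap o j), hN.trans (permute _ _ _), ?_, ?_⟩
  · simpa using h0
  · intro K hK a b hab
    simp only [submatrix_apply, Equiv.swap_apply_left]
    rw [hk]
    exact Nat.find_min' hex ⟨K, hK, a, b, hab, rfl⟩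

end UnitEquivalent

/-- A minimal pivot divides its row and its column, so both can be cleared. -/
theorem exists_unitEquivalent_fromBlocks {n : ℕ} (M : Matrix (Unit ⊕ Fin n) (Unit ⊕ Fin n) ℤ) :
    ∃ (a : ℤ) (B : Matrix (Fin n) (Fin n) ℤ), (∀ i j, a ∣ B i j) ∧
      UnitEquivalent M (fromBlocks (of fun _ _ => a) 0 0 B) := by
  by_cases hM : M = 0
  · exact ⟨0, 0, by simp, by
      subst hM
      convert UnitEquivalent.refl (0 : Matrix (Unit ⊕ Fin n) (Unit ⊕ Fin n) ℤ)
      ext (_ | _) (_ | _) <;> simp⟩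
  obtain ⟨N, hN, h0, hmin⟩ := UnitEquivalent.exists_pivot M hM (Sum.inl ())
  have hrow := hN.dvd_row (Sum.inl ()) hmin h0
  have hcol := hN.transpose.dvd_row (Sum.inl ())
    (fun K hK i j hij => hmin Kᵀ hK.transpose j i hij) h0
  set a := N (Sum.inl ()) (Sum.inl ()) with ha
  choose r hr using hrow
  choose c hc using hcol
  change ∀ j, N j (Sum.inl ()) = a * c j at hc
  have hblock : UnitEquivalent M (fromBlocks (of fun _ _ => a) 0 0
      (of fun i j => N (Sum.inr i) (Sum.inr j) - c (Sum.inr i) * a * r (Sum.inr j))) := by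
    refine (hN.trans (UnitEquivalent.mul_left _
      (fromBlocks 1 0 (of fun i _ => -c (Sum.inr i)) 1) (by simp))).trans ?_
    have hQ := UnitEquivalent.mul_right
      (fromBlocks (1 : Matrix Unit Unit ℤ) 0 (of fun i _ => -c (Sum.inr i)) 1 * N)
      (fromBlocks 1 (of fun _ j => -r (Sum.inr j)) 0 1) (by simp)
    convert hQ using 1
    rw [← fromBlocks_toBlocks N, fromBlocks_multiply, fromBlocks_multiply]
    congr 1
    · ext i j
      simp [toBlocks₁₁, ha]
    · ext i j
      simp [toBlocks₁₁, toBlocks₁₂, mul_apply, ← ha, hr (Sum.inr j)]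
    · ext i j
      simp [toBlocks₁₁, toBlocks₂₁, mul_apply, ← ha, hc (Sum.inr i), mul_comm]
    · ext i j
      simp [toBlocks₁₁, toBlocks₂₁, toBlocks₁₂, toBlocks₂₂, mul_apply, ← ha, hc (Sum.inr i),
        hr (Sum.inr j)]
      ring
  refine ⟨a, _, ?_, hblock⟩
  intro i j
  -- Adding row `i` of the block to the pivot row leaves the pivot unchanged and still minimal, so
  -- it divides the entries that have moved into its row.
  have h1 := hblock.trans (UnitEquivalent.mul_left _ (transvection (Sum.inl ()) (Sum.inr i) 1)
    (det_transvection_of_ne _ _ (by simp) _))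
  have h2 := h1.dvd_row (Sum.inl ()) (by
    rw [transvection_mul_apply_same]
    simpa using hmin) (by rw [transvection_mul_apply_same]; simpa using h0) (Sum.inr j)
  rw [transvection_mul_apply_same, transvection_mul_apply_same] at h2
  simpa using h2

/-- The Smith normal form of a square integer matrix. -/
theorem exists_unitEquivalent_diagonal {n : ℕ} (M : Matrix (Fin n) (Fin n) ℤ) :
    ∃ d : Fin n → ℤ, (∀ i j, i ≤ j → d i ∣ d j) ∧ UnitEquivalent M (diagonal d) := by
  induction n with
  | zero => exact ⟨Fin.elim0, fun i => i.elim0, 1, 1, isUnit_one, isUnit_one, by ext i; exact i.elim0⟩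
  | succ n ih =>
    let e : Unit ⊕ Fin n ≃ Fin (n + 1) :=
      { toFun := Sum.elim (fun _ => 0) Fin.succ
        invFun := Fin.cases (Sum.inl ()) Sum.inr
        left_inv := by rintro (_ | _) <;> simp
        right_inv := by intro i; cases i using Fin.cases <;> simp }
    obtain ⟨a, B, hB, hM⟩ := exists_unitEquivalent_fromBlocks (M.submatrix e e)
    obtain ⟨d, hd, P, Q, hP, hQ, hPQ⟩ := ih B
    have had : ∀ i, a ∣ d i := by
      intro i
      have h1 : d i = (P * B * Q) i i := by rw [← hPQ, diagonal_apply_eq]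
      rw [h1, mul_apply]
      refine Finset.dvd_sum fun k _ => Dvd.dvd.mul_right ?_ _
      rw [mul_apply]
      exact Finset.dvd_sum fun l _ => Dvd.dvd.mul_left (hB _ _) _
    refine ⟨Fin.cons a d, ?_, ?_⟩
    · intro i j hij
      cases i using Fin.cases with
      | zero =>
        cases j using Fin.cases with
        | zero => simp
        | succ j => simpa using had j
      | succ i =>
        cases j using Fin.cases with
        | zero => simp at hij
        | succ j => simpa using hd i j (by simpa using hij)
    · have h1 : UnitEquivalent (M.submatrix e e) (fromBlocks (of fun _ _ => a) 0 0 (diagonal d)) := by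
        refine hM.trans ⟨fromBlocks 1 0 0 P, fromBlocks 1 0 0 Q, ?_, ?_, ?_⟩
        · rw [isUnit_iff_isUnit_det] at hP ⊢
          simpa using hP
        · rw [isUnit_iff_isUnit_det] at hQ ⊢
          simpa using hQ
        · rw [fromBlocks_multiply, fromBlocks_multiply]
          simp [hPQ]
      have h2 := h1.submatrix_equiv e.symm
      convert h2 using 1
      · ext i j
        simp
      · ext i j
        cases i using Fin.cases <;> cases j using Fin.cases <;>
          simp [e, diagonal_apply, (Fin.succ_ne_zero _).symm]

end Matrix

/-! ### Torsion products and kernels of integer matrices acting on an abelian group. -/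

theorem AddSubgroup.nonempty_addEquiv_of_existsUnique {G H : Type*} [AddCommGroup G]
    [AddCommGroup H] (R : AddSubgroup (G × H)) (hG : ∀ g, ∃! h, (g, h) ∈ R)
    (hH : ∀ h, ∃! g, (g, h) ∈ R) : Nonempty (G ≃+ H) := by
  have h1 : Function.Bijective ((AddMonoidHom.fst G H).comp R.subtype) := by
    constructor
    · rintro ⟨⟨g, h⟩, hr⟩ ⟨⟨g', h'⟩, hr'⟩ heq
      obtain rfl : g = g' := heq
      obtain rfl := (hG g).unique hr hr'
      rfl
    · intro g
      obtain ⟨h, hr, -⟩ := hG g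
      exact ⟨⟨(g, h), hr⟩, rfl⟩
  have h2 : Function.Bijective ((AddMonoidHom.snd G H).comp R.subtype) := by
    constructor
    · rintro ⟨⟨g, h⟩, hr⟩ ⟨⟨g', h'⟩, hr'⟩ heq
      obtain rfl : h = h' := heq
      obtain rfl := (hH h).unique hr hr'
      rfl
    · intro h
      obtain ⟨g, hr, -⟩ := hH h
      exact ⟨⟨(g, h), hr⟩, rfl⟩
  exact ⟨(AddEquiv.ofBijective _ h1).symm.trans (AddEquiv.ofBijective _ h2)⟩

/-- The families `v` in `A` with `k i • v i = 0` for all `i`. -/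
def torsionPi {r : ℕ} (k : Fin r → ℕ) (A : Type*) [AddCommGroup A] : AddSubgroup (Fin r → A) where
  carrier := {v | ∀ i, k i • v i = 0}
  zero_mem' := fun i => smul_zero _
  add_mem' := fun hv hw i => by rw [Pi.add_apply, smul_add, hv i, hw i, add_zero]
  neg_mem' := fun hv i => by rw [Pi.neg_apply, smul_neg, hv i, neg_zero]

/-- Torsion with respect to `0` is no condition. This splits off the factor `A` that belongs to
`φ_0`. -/
theorem nonempty_torsionPi_addEquiv_of_zero {r : ℕ} (k : Fin (r + 1) → ℕ) (hk : k 0 = 0)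
    (A : Type*) [AddCommGroup A] :
    Nonempty (torsionPi k A ≃+ A × torsionPi (fun j => k j.succ) A) :=
  ⟨{ toFun := fun v => (v.1 0, ⟨fun j => v.1 j.succ, fun j => v.2 j.succ⟩)
     invFun := fun w => ⟨Fin.cons w.1 w.2.1, fun j => by
      cases j using Fin.cases with
      | zero => simp [hk]
      | succ j => simpa using w.2.2 j⟩
     left_inv := fun v => by
      ext j
      cases j using Fin.cases <;> simp
     right_inv := fun w => by
      ext j <;> simp
     map_add' := fun v w => rfl }⟩

namespace Matrix

variable {l m n : Type*} [Fintype m] [Fintype n] (A : Type*) [AddCommGroup A]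

/-- The kernel of an integer matrix that acts on families in an abelian group. -/
def kerIn (M : Matrix l n ℤ) : AddSubgroup (n → A) where
  carrier := {v | ∀ i, ∑ j, M i j • v j = 0}
  zero_mem' := fun i => by simp
  add_mem' := fun {v w} hv hw i => by
    simp only [Pi.add_apply, smul_add, Finset.sum_add_distrib]
    rw [hv i, hw i, add_zero]
  neg_mem' := fun {v} hv i => by
    simp only [Pi.neg_apply, smul_neg, Finset.sum_neg_distrib]
    rw [hv i, neg_zero]

variable {A}

theorem sum_mul_smul (M : Matrix l m ℤ) (N : Matrix m n ℤ) (v : n → A) (i : l) :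
    ∑ j, (M * N) i j • v j = ∑ k, M i k • ∑ j, N k j • v j := by
  simp only [mul_apply, Finset.sum_smul, Finset.smul_sum, mul_smul]
  exact Finset.sum_comm

theorem sum_one_smul [DecidableEq n] (v : n → A) (i : n) :
    ∑ j, (1 : Matrix n n ℤ) i j • v j = v i := by
  simp [one_apply]

/-- The factor on the left only recombines the equations, while `Q` is a change of variables that
maps the kernel of `P * M * Q` onto that of `M`. -/
theorem UnitEquivalent.nonempty_kerIn_addEquiv [DecidableEq n] {M N : Matrix n n ℤ}
    (h : UnitEquivalent M N) : Nonempty (M.kerIn A ≃+ N.kerIn A) := by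
  obtain ⟨P, Q, ⟨p, rfl⟩, ⟨q, rfl⟩, rfl⟩ := h
  refine ⟨AddEquiv.symm
    { toFun := fun v => ⟨fun i => ∑ j, (q : Matrix n n ℤ) i j • v.1 j, fun i => ?_⟩
      invFun := fun v => ⟨fun i => ∑ j, (↑q⁻¹ : Matrix n n ℤ) i j • v.1 j, fun i => ?_⟩
      left_inv := fun v => ?_
      right_inv := fun v => ?_
      map_add' := fun v w => ?_ }⟩
  · have hv : ∀ i, ∑ j, (p * M * q : Matrix n n ℤ) i j • v.1 j = 0 := v.2
    rw [← sum_mul_smul]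
    have h1 : M * (q : Matrix n n ℤ) = (↑p⁻¹ : Matrix n n ℤ) * (p * M * q) := by simp [mul_assoc]
    rw [h1, sum_mul_smul]
    simp [hv]
  · have hv : ∀ i, ∑ j, M i j • v.1 j = 0 := v.2
    rw [← sum_mul_smul, mul_assoc, Units.mul_inv, mul_one, sum_mul_smul]
    simp [hv]
  · ext i
    change ∑ j, (↑q⁻¹ : Matrix n n ℤ) i j • ∑ k, (q : Matrix n n ℤ) j k • v.1 k = _
    rw [← sum_mul_smul, Units.inv_mul, sum_one_smul]
  · ext i
    change ∑ j, (q : Matrix n n ℤ) i j • ∑ k, (↑q⁻¹ : Matrix n n ℤ) j k • v.1 k = _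
    rw [← sum_mul_smul, Units.mul_inv, sum_one_smul]
  · ext i
    simp [Finset.sum_add_distrib]

theorem nonempty_kerIn_submatrix_addEquiv (M : Matrix m m ℤ) (e : n ≃ m) :
    Nonempty (M.kerIn A ≃+ (M.submatrix e e).kerIn A) :=
  ⟨{ toFun := fun v => ⟨fun i => v.1 (e i), fun i => by
      rw [← v.2 (e i)]
      exact Fintype.sum_equiv e _ _ fun j => rfl⟩
     invFun := fun v => ⟨fun i => v.1 (e.symm i), fun i => by
      rw [← v.2 (e.symm i)]
      refine Fintype.sum_equiv e.symm _ _ fun j => by simp⟩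
     left_inv := fun v => by ext; simp
     right_inv := fun v => by ext; simp
     map_add' := fun v w => rfl }⟩

/-- In Smith normal form the equations decouple. Signs of the diagonal entries do not affect
torsion. -/
theorem nonempty_kerIn_addEquiv_torsionPi (M : Matrix m m ℤ) {r : ℕ} (hr : Fintype.card m = r) :
    Nonempty (M.kerIn A ≃+ torsionPi (fun j : Fin r => M.invariantFactor j) A) := by
  classical
  let e : Fin r ≃ m := (Fintype.equivFinOfCardEq hr).symm
  obtain ⟨d, hd, hM⟩ := exists_unitEquivalent_diagonal (M.submatrix e e)
  -- The order is reversed: each diagonal entry divides the next one, whereas `invariantFactor`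
  -- starts from the last.
  have hphi : ∀ j : Fin r, M.invariantFactor j = (d j.rev).natAbs := by
    intro j
    have h1 : ∀ k, M.elementaryIdeal k = (diagonal d).elementaryIdeal k := by
      intro k
      obtain ⟨P, Q, hP, hQ, h⟩ := hM
      rw [h, elementaryIdeal_unit_mul_unit _ _ _ hP hQ, elementaryIdeal_submatrix_equiv]
    have h2 : M.invariantFactor j = (diagonal d).invariantFactor j := by
      unfold invariantFactor elementaryGcd
      simp only [h1]
    rw [h2, invariantFactor_diagonal d hd j j.2]
    congr 2
    ext
    simp
    omega
  obtain ⟨f⟩ := nonempty_kerIn_submatrix_addEquiv (A := A) M e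
  obtain ⟨g⟩ := hM.nonempty_kerIn_addEquiv (A := A)
  have hz : ∀ (z : ℤ) (a : A), z.natAbs • a = 0 ↔ z • a = 0 := by
    intro z a
    obtain h | h := Int.natAbs_eq z
    · conv_rhs => rw [h, natCast_zsmul]
    · conv_rhs => rw [h, neg_smul, natCast_zsmul, neg_eq_zero]
  have hker : ∀ v : Fin r → A, v ∈ (diagonal d).kerIn A ↔ ∀ i, d i • v i = 0 := by
    intro v
    refine forall_congr' fun i => ?_
    simp [diagonal_apply]
  refine ⟨(f.trans g).trans
    { toFun := fun v => ⟨fun j => v.1 j.rev, fun j => ?_⟩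
      invFun := fun v => ⟨fun j => v.1 j.rev, (hker _).2 fun j => ?_⟩
      left_inv := fun v => by ext; simp
      right_inv := fun v => by ext; simp
      map_add' := fun v w => rfl }⟩
  · change M.invariantFactor j • v.1 j.rev = 0
    rw [hphi, hz]
    exact (hker _).1 v.2 j.rev
  · have : M.invariantFactor j.rev • v.1 j.rev = 0 := v.2 j.rev
    rwa [hphi, hz, Fin.rev_rev] at this

/-- The minors of full size are the determinant up to sign, and a nonzero vector in the kernel makes
it vanish; the quotient `0 / δ_1` is then `0`. -/
theorem invariantFactor_zero_eq_zero [DecidableEq n] (M : Matrix n n ℤ) (v : n → ℤ) (hv : v ≠ 0)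
    (h : M *ᵥ v = 0) : M.invariantFactor 0 = 0 := by
  have hdet : M.det = 0 := exists_mulVec_eq_zero_iff.1 ⟨v, hv, h⟩
  have h1 : M.elementaryIdeal 0 = Ideal.span {0} := by
    rw [Ideal.span_singleton_eq_bot.2 rfl, elementaryIdeal, Ideal.span_eq_bot]
    rintro x ⟨r, c, rfl⟩
    let e : Fin (Fintype.card n - 0) ≃ n := Equiv.ofBijective c
      ((Fintype.bijective_iff_injective_and_card _).2 ⟨c.injective, by simp⟩)
    let f : Fin (Fintype.card n - 0) ≃ n := Equiv.ofBijective r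
      ((Fintype.bijective_iff_injective_and_card _).2 ⟨r.injective, by simp⟩)
    have h2 : M.submatrix r c = (M.submatrix (e.symm.trans f) id).submatrix e e := by
      ext i j
      simp [e, f]
    rw [h2, det_submatrix_equiv_self, det_permute, hdet, mul_zero]
  rw [invariantFactor, elementaryGcd_eq_of_ideal _ _ _ h1]
  simp

end Matrix

namespace ClassicalLink

/-! ### Level colorings

A coloring of the gaps of a word is a sequence of functions `ℕ → A`, one for each level; the gaps
beyond the last strand are included, their colors are just carried along. -/

section LevelColorings

variable {A : Type*} [AddCommGroup A]

/-- The color above a crossing, from the colors on its left, below it, and on its right. -/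
def crossValue (b : Bool) (p q r : A) : A := if b then p + q - r else r + q - p

/-- The colorings of the levels below and above the event that are compatible. -/
def Event.rel (e : Event) (A : Type*) [AddCommGroup A] : AddSubgroup ((ℕ → A) × (ℕ → A)) where
  carrier := {p | (∀ g h, e.Joins g h → p.2 h = p.1 g) ∧ ∀ b, e.kind = .cross b →
    p.2 (e.pos + 1) = crossValue b (p.1 e.pos) (p.1 (e.pos + 1)) (p.1 (e.pos + 2))}
  zero_mem' := ⟨fun _ _ _ => rfl, fun b _ => by simp [crossValue]⟩
  add_mem' := fun {p q} hp hq => ⟨fun g h hgh => by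
    simp only [Prod.snd_add, Prod.fst_add, Pi.add_apply, hp.1 g h hgh, hq.1 g h hgh],
    fun b hb => by
      simp only [Prod.snd_add, Prod.fst_add, Pi.add_apply, hp.2 b hb, hq.2 b hb, crossValue]
      split_ifs <;> abel⟩
  neg_mem' := fun {p} hp => ⟨fun g h hgh => by
    simp only [Prod.snd_neg, Prod.fst_neg, Pi.neg_apply, hp.1 g h hgh],
    fun b hb => by
      simp only [Prod.snd_neg, Prod.fst_neg, Pi.neg_apply, hp.2 b hb, crossValue]
      split_ifs <;> abel⟩

/-- The effect of a crossing on a level coloring. -/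
def crossFun (i : ℕ) (b : Bool) (x : ℕ → A) : ℕ → A :=
  Function.update x (i + 1) (crossValue b (x i) (x (i + 1)) (x (i + 2)))

theorem crossFun_of_eq {i k : ℕ} (h : k = i + 1) (b : Bool) (x : ℕ → A) :
    crossFun i b x k = crossValue b (x i) (x k) (x (k + 1)) := by
  subst h
  simp [crossFun]

theorem crossFun_of_ne {i k : ℕ} (h : k ≠ i + 1) (b : Bool) (x : ℕ → A) :
    crossFun i b x k = x k :=
  Function.update_of_ne h _ _

theorem mem_rel_cross {i : ℕ} {b : Bool} {x y : ℕ → A} :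
    (x, y) ∈ (cross i b).rel A ↔ y = crossFun i b x := by
  constructor
  · rintro ⟨h1, h2⟩
    ext h
    by_cases hh : h = i + 1
    · subst hh
      rw [crossFun_of_eq rfl]
      exact h2 b rfl
    · rw [crossFun, Function.update_of_ne hh]
      refine h1 h h ?_
      by_cases h3 : h ≤ i
      · exact Or.inl ⟨h3, rfl⟩
      · exact Or.inr ⟨show i + 2 ≤ h by omega, rfl⟩
  · rintro rfl
    refine ⟨?_, ?_⟩
    · intro g h hgh
      simp only [Event.Joins, cross, EventKind.src, EventKind.tgt] at hgh
      change crossFun i b x h = x g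
      rw [crossFun, Function.update_of_ne (by omega)]
      congr 1
      omega
    · intro c hc
      simp only [cross, EventKind.cross.injEq] at hc
      subst hc
      simp [crossFun, cross]

theorem mem_rel_cup {i : ℕ} {x y : ℕ → A} :
    (x, y) ∈ (cup i).rel A ↔ (∀ h ≤ i, y h = x h) ∧ ∀ h, i ≤ h → y (h + 2) = x h := by
  constructor
  · rintro ⟨h1, -⟩
    exact ⟨fun h hh => h1 h h (Or.inl ⟨hh, rfl⟩), fun h hh => h1 h (h + 2) (Or.inr ⟨hh, rfl⟩)⟩
  · rintro ⟨h1, h2⟩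
    refine ⟨?_, fun b hb => by simp [cup] at hb⟩
    rintro g h (⟨hg, rfl⟩ | ⟨hg, hgh⟩)
    · exact h1 _ hg
    · simp only [cup, EventKind.src, EventKind.tgt] at hg hgh
      obtain rfl : h = g + 2 := by omega
      exact h2 _ hg

theorem mem_rel_cap {i : ℕ} {x y : ℕ → A} :
    (x, y) ∈ (cap i).rel A ↔ (∀ h ≤ i, x h = y h) ∧ ∀ h, i ≤ h → x (h + 2) = y h := by
  constructor
  · rintro ⟨h1, -⟩
    refine ⟨fun h hh => (h1 h h (Or.inl ⟨hh, rfl⟩)).symm, fun h hh =>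
      (h1 (h + 2) h (Or.inr ⟨?_, rfl⟩)).symm⟩
    simp only [cap, EventKind.src]
    omega
  · rintro ⟨h1, h2⟩
    refine ⟨?_, fun b hb => by simp [cap] at hb⟩
    rintro g h (⟨hg, rfl⟩ | ⟨hg, hgh⟩)
    · exact (h1 _ hg).symm
    · simp only [cap, EventKind.src, EventKind.tgt] at hg hgh
      obtain rfl : g = h + 2 := by omega
      exact (h2 _ (by omega)).symm

theorem crossFun_not_crossFun (i : ℕ) (b : Bool) (x : ℕ → A) :
    crossFun i (!b) (crossFun i b x) = x := by
  ext h
  by_cases hh : h = i + 1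
  · subst hh
    cases b <;> simp [crossFun, crossValue]
  · simp [crossFun, hh]

theorem crossFun_braid (i : ℕ) (a b c : Bool) (h : b = a ∨ b = c) (x : ℕ → A) :
    crossFun i c (crossFun (i + 1) b (crossFun i a x)) =
      crossFun (i + 1) a (crossFun i b (crossFun (i + 1) c x)) := by
  ext k
  by_cases h1 : k = i + 1
  · subst h1
    simp (disch := omega) only [crossFun_of_eq, crossFun_of_ne, add_assoc, Nat.reduceAdd]
    rcases h with rfl | rfl <;> cases b <;> (try cases a) <;> (try cases c) <;>
      simp only [crossValue, if_true, Bool.false_eq_true, if_false] <;> abel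
  · by_cases h2 : k = i + 2
    · subst h2
      simp (disch := omega) only [crossFun_of_eq, crossFun_of_ne, add_assoc, Nat.reduceAdd]
      rcases h with rfl | rfl <;> cases b <;> (try cases a) <;> (try cases c) <;>
        simp only [crossValue, if_true, Bool.false_eq_true, if_false] <;> abel
    · simp (disch := omega) only [crossFun_of_ne]

/-- The event upside down. -/
def Event.mirror : Event → Event
  | ⟨.cup, i⟩ => ⟨.cap, i⟩
  | ⟨.cap, i⟩ => ⟨.cup, i⟩
  | ⟨.cross b, i⟩ => ⟨.cross (!b), i⟩

/-- Through this symmetry, statements about maxima follow from those about minima. -/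
theorem mem_rel_mirror (e : Event) (x y : ℕ → A) : (x, y) ∈ e.mirror.rel A ↔ (y, x) ∈ e.rel A := by
  rcases e with ⟨_ | _ | b, i⟩
  · exact (mem_rel_cap (i := i)).trans mem_rel_cup.symm
  · exact (mem_rel_cup (i := i)).trans mem_rel_cap.symm
  · refine (mem_rel_cross (i := i)).trans (Iff.trans ?_ mem_rel_cross.symm)
    constructor
    · rintro rfl
      have := crossFun_not_crossFun i (!b) x
      rw [Bool.not_not] at this
      exact this.symm
    · rintro rfl
      exact (crossFun_not_crossFun i b y).symm

/-- Some coloring of the word has the given colors at the bottom and the top. -/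
def Reach : List Event → (ℕ → A) → (ℕ → A) → Prop
  | [], x, z => x = z
  | e :: w, x, z => ∃ y, (x, y) ∈ e.rel A ∧ Reach w y z

theorem reach_pair {e f : Event} {x z : ℕ → A} :
    Reach [e, f] x z ↔ ∃ y, (x, y) ∈ e.rel A ∧ (y, z) ∈ f.rel A := by
  simp [Reach]

theorem reach_single {e : Event} {x z : ℕ → A} : Reach [e] x z ↔ (x, z) ∈ e.rel A := by
  simp [Reach]

theorem reach_pair_mirror {e f : Event} {x z : ℕ → A} :
    Reach [e.mirror, f.mirror] x z ↔ Reach [f, e] z x := by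
  simp only [reach_pair, mem_rel_mirror]
  exact exists_congr fun y => and_comm

theorem reach_far {a b : EventKind} {i k : ℕ} {x z : ℕ → A}
    (h : Reach [⟨a, i⟩, ⟨b, i + a.tgt + k⟩] x z) :
    Reach [⟨b, i + a.src + k⟩, ⟨a, i⟩] x z := by
  rw [reach_pair] at h ⊢
  obtain ⟨y, ⟨ha1, ha2⟩, ⟨hb1, hb2⟩⟩ := h
  simp only [Event.Joins] at ha1 ha2 hb1 hb2
  have hl : ∀ g ≤ i, y g = x g := fun g hg => ha1 g g (Or.inl ⟨hg, rfl⟩)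
  have hm : ∀ j, y (i + a.tgt + j) = x (i + a.src + j) := fun j =>
    ha1 _ _ (Or.inr ⟨by omega, by omega⟩)
  have hl' : ∀ g ≤ i + a.tgt + k, z g = y g := fun g hg => hb1 g g (Or.inl ⟨hg, rfl⟩)
  have hm' : ∀ j, z (i + a.tgt + k + b.tgt + j) = y (i + a.tgt + k + b.src + j) := fun j =>
    hb1 _ _ (Or.inr ⟨by omega, by omega⟩)
  -- In the exchanged order, `b` has happened at the middle level and `a` has not. Up to the
  -- position of `b` the colors are still those of the bottom; beyond it they are those of the top,
  -- with the shift caused by `a` undone.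
  refine ⟨fun h => if h ≤ i + a.src + k then x h else z (h + a.tgt - a.src), ⟨?_, ?_⟩, ?_, ?_⟩
  · rintro g h (⟨hg, rfl⟩ | ⟨hg, hgh⟩)
    · exact if_pos hg
    · simp only at hg hgh ⊢
      obtain ⟨j, rfl⟩ := Nat.exists_eq_add_of_le hg
      have e0 := hm (k + b.src + j)
      have e2 := hm k
      simp only [← add_assoc] at e0 e2
      have e1 : x (i + a.src + k + b.src + j) = z (i + a.tgt + k + b.tgt + j) := by
        rw [hm', e0]
      split_ifs with hh
      · obtain rfl : h = i + a.src + k := by omega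
        rw [e1, ← e2, ← hl' _ le_rfl]
        congr 1
        omega
      · rw [e1]
        congr 1
        omega
  · intro c hc
    simp only at hc ⊢
    subst hc
    have h1 := hb2 c rfl
    have h2 := hm (k + 1)
    have h3 := hm (k + 2)
    have h4 := hm k
    simp only [← add_assoc] at h1 h2 h3 h4
    rw [if_neg (by omega), ← h2, ← h3, ← h4, ← h1]
    congr 1
    omega
  · rintro g h (⟨hg, rfl⟩ | ⟨hg, hgh⟩)
    · simp only at hg ⊢
      rw [if_pos (by omega), hl' _ (by omega), hl _ hg]
    · simp only at hg hgh ⊢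
      obtain ⟨j, rfl⟩ := Nat.exists_eq_add_of_le hg
      obtain rfl : h = i + a.tgt + j := by omega
      split_ifs with hh
      · rw [hl' _ (by omega), hm]
      · congr 1
        omega
  · intro c hc
    have h1 := ha2 c hc
    change a = _ at hc
    simp only
    have hs : a.src = 2 := by rw [hc]; rfl
    have ht : a.tgt = 2 := by rw [hc]; rfl
    rw [if_pos (by omega), if_pos (by omega), if_pos (by omega), ← h1, hl' _ (by omega)]

/-- Turning the picture upside down interchanges `src` and `tgt`, and so reduces the converse to
`reach_far`. -/
theorem reach_far_iff {a b : EventKind} {i k : ℕ} {x z : ℕ → A} :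
    Reach [⟨a, i⟩, ⟨b, i + a.tgt + k⟩] x z ↔ Reach [⟨b, i + a.src + k⟩, ⟨a, i⟩] x z := by
  refine ⟨reach_far, fun h => ?_⟩
  have h1 := reach_pair_mirror.2 h
  have key : ∀ e : EventKind, ∃ e' : EventKind, (∀ j, (⟨e, j⟩ : Event).mirror = ⟨e', j⟩) ∧
      e'.src = e.tgt ∧ e'.tgt = e.src := by
    rintro (_ | _ | c)
    · exact ⟨.cap, fun _ => rfl, rfl, rfl⟩
    · exact ⟨.cup, fun _ => rfl, rfl, rfl⟩
    · exact ⟨.cross (!c), fun _ => rfl, rfl, rfl⟩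
  obtain ⟨a', ha, hs, ht⟩ := key a
  obtain ⟨b', hb, -, -⟩ := key b
  rw [ha, hb, ← ht] at h1
  have h2 := reach_far h1
  rw [hs, ← ha, ← hb] at h2
  exact reach_pair_mirror.1 h2

theorem reach_zigzag {i : ℕ} {x z : ℕ → A} : Reach [cup (i + 1), cap i] x z ↔ x = z := by
  rw [reach_pair]
  simp only [mem_rel_cup, mem_rel_cap]
  constructor
  · rintro ⟨y, ⟨h1, h2⟩, h3, h4⟩
    ext h
    rcases Nat.lt_or_ge i h with hi | hi
    · rw [← h2 h hi, h4 h hi.le]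
    · rw [← h1 h (by omega), h3 h hi]
  · rintro rfl
    -- The gap `i + 2` inside the minimum is joined by the maximum to the gap `i`, which forces its
    -- color.
    refine ⟨fun h => if h ≤ i + 1 then x h else if h = i + 2 then x i else x (h - 2),
      ⟨?_, ?_⟩, ?_, ?_⟩
    · intro h hh
      simp [hh]
    · intro h hh
      simp only
      rw [if_neg (by omega), if_neg (by omega)]
      rfl
    · intro h hh
      simp only
      rw [if_pos (by omega)]
    · intro h hh
      simp only
      rw [if_neg (by omega)]
      split_ifs with h1
      · congr 1
        omega
      · rfl

theorem reach_slide_cup {i : ℕ} {b : Bool} {x z : ℕ → A} :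
    Reach [cup i, cross (i + 1) b] x z ↔ Reach [cup (i + 1), cross i (!b)] x z := by
  simp only [reach_pair, mem_rel_cup, mem_rel_cross]
  constructor
  · rintro ⟨y, ⟨h1, h2⟩, rfl⟩
    have e0 := h1 i le_rfl
    have e2 := h2 i le_rfl
    have e3 := h2 (i + 1) (by omega)
    simp only [add_assoc, Nat.reduceAdd] at e3
    -- Only the gap inside the new minimum is free. The crossing of the new word leaves it alone, so
    -- its color is the one that the old word shows at the top.
    refine ⟨fun h => if h ≤ i + 1 then x h else if h = i + 2 then
      crossValue b (y (i + 1)) (x i) (x (i + 1)) else x (h - 2), ⟨?_, ?_⟩, ?_⟩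
    · intro h hh
      simp [hh]
    · intro h hh
      simp only
      rw [if_neg (by omega), if_neg (by omega)]
      rfl
    · ext h
      rcases lt_trichotomy h (i + 1) with hh | rfl | hh
      · simp (disch := omega) only [crossFun_of_ne, if_pos, h1]
      · simp (disch := omega) only [crossFun_of_eq, crossFun_of_ne, if_pos, if_neg, add_assoc,
          Nat.reduceAdd]
        cases b <;> simp only [crossValue, if_true, Bool.not_true, Bool.not_false,
            Bool.false_eq_true, if_false] <;> abel
      · rcases Nat.lt_or_ge (i + 2) h with h3 | h3
        · obtain ⟨j, rfl⟩ := Nat.exists_eq_add_of_le (show 2 ≤ h by omega)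
          rw [add_comm 2 j]
          simp (disch := omega) only [crossFun_of_ne, if_neg, h2, Nat.add_sub_cancel]
        · obtain rfl : h = i + 2 := by omega
          simp (disch := omega) only [crossFun_of_eq, crossFun_of_ne, if_neg, add_assoc,
            Nat.reduceAdd, Nat.reduceSubDiff, e2, e3]
          cases b <;> simp only [crossValue, if_true,
            Bool.false_eq_true, if_false]
  · rintro ⟨y, ⟨h1, h2⟩, rfl⟩
    have e0 := h1 i (by omega)
    have e1 := h1 (i + 1) (by omega)
    have e3 := h2 (i + 1) (by omega)
    simp only [add_assoc, Nat.reduceAdd] at e3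
    refine ⟨fun h => if h ≤ i then x h else if h = i + 1 then
      crossValue (!b) (x i) (x (i + 1)) (y (i + 2)) else x (h - 2), ⟨?_, ?_⟩, ?_⟩
    · intro h hh
      simp [hh]
    · intro h hh
      simp only
      rw [if_neg (by omega), if_neg (by omega)]
      rfl
    · ext h
      rcases lt_trichotomy h (i + 1) with hh | rfl | hh
      · simp (disch := omega) only [crossFun_of_ne, if_pos, h1]
      · simp (disch := omega) only [crossFun_of_eq, crossFun_of_ne, if_neg, add_assoc,
          Nat.reduceAdd, e0, e1]
        cases b <;> simp only [crossValue, if_true, Bool.not_true, Bool.not_false,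
            Bool.false_eq_true, if_false]
      · rcases Nat.lt_or_ge (i + 2) h with h3 | h3
        · obtain ⟨j, rfl⟩ := Nat.exists_eq_add_of_le (show 2 ≤ h by omega)
          rw [add_comm 2 j]
          simp (disch := omega) only [crossFun_of_ne, if_neg, h2, Nat.add_sub_cancel]
        · obtain rfl : h = i + 2 := by omega
          simp (disch := omega) only [crossFun_of_eq, crossFun_of_ne, if_neg, add_assoc,
            Nat.reduceAdd, Nat.reduceSubDiff]
          cases b <;> simp only [crossValue, if_true, Bool.not_true, Bool.not_false,
            Bool.false_eq_true, if_false] <;> abel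

/-- The gaps on both sides of a minimum have equal colors, so their contributions to `crossValue`
cancel and the crossing changes nothing. -/
theorem reach_reidemeister_one {i : ℕ} {b : Bool} {x z : ℕ → A} :
    Reach [cup i, cross i b] x z ↔ Reach [cup i] x z := by
  rw [reach_pair, reach_single]
  simp only [mem_rel_cross]
  have key : ∀ y : ℕ → A, (x, y) ∈ (cup i).rel A → crossFun i b y = y := by
    intro y hy
    rw [mem_rel_cup] at hy
    have e0 := hy.1 i le_rfl
    have e2 := hy.2 i le_rfl
    rw [crossFun, Function.update_eq_self_iff]
    cases b <;> simp [crossValue, e0, e2]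
  constructor
  · rintro ⟨y, hy, rfl⟩
    rwa [key y hy]
  · intro h
    exact ⟨z, h, (key z h).symm⟩

theorem LocalMove.reach_iff {s t : List Event} (h : LocalMove s t) (x z : ℕ → A) :
    Reach s x z ↔ Reach t x z := by
  cases h with
  | far a b i k => exact reach_far_iff
  | zigzag_left i => exact reach_zigzag
  | zigzag_right i =>
    exact (reach_pair_mirror (e := cap i) (f := cup (i + 1))).trans
      (reach_zigzag.trans eq_comm)
  | slide_cup i b => exact reach_slide_cup
  | slide_cap i b =>
    have h := (reach_pair_mirror (e := cross (i + 1) (!b)) (f := cup i) (x := x) (z := z)).trans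
      (reach_slide_cup.trans (reach_pair_mirror (e := cross i (!!b)) (f := cup (i + 1))).symm)
    cases b <;> exact h
  | reidemeister_one_cup i b => exact reach_reidemeister_one
  | reidemeister_one_cap i b =>
    have h := reach_reidemeister_one (i := i) (b := !b) (x := z) (z := x)
    rw [← reach_pair_mirror, reach_single, ← mem_rel_mirror, ← reach_single] at h
    simpa [Event.mirror, cup, cross, cap] using h
  | reidemeister_two i b =>
    simp only [Reach, mem_rel_cross, exists_eq_left, crossFun_not_crossFun]
  | reidemeister_three i a b c h =>
    simp only [Reach, mem_rel_cross, exists_eq_left, crossFun_braid i a b c h]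

end LevelColorings

end ClassicalLink

/-! ### Colorings of whole words, and their transport along local moves. -/

namespace ClassicalLink

section LevelColorings

variable {A : Type*} [AddCommGroup A]

/-- The sequence of level functions is a coloring of the word. -/
def Colors (w : List Event) (Y : ℕ → ℕ → A) : Prop :=
  ∀ k e, w[k]? = some e → (Y k, Y (k + 1)) ∈ e.rel A

theorem colors_nil (Y : ℕ → ℕ → A) : Colors [] Y := by
  intro k e h
  simp at h

theorem colors_cons {e : Event} {w : List Event} {Y : ℕ → ℕ → A} :
    Colors (e :: w) Y ↔ (Y 0, Y 1) ∈ e.rel A ∧ Colors w fun k => Y (k + 1) := by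
  constructor
  · intro h
    exact ⟨h 0 e rfl, fun k f hf => h (k + 1) f hf⟩
  · rintro ⟨h0, h⟩ (_ | k) f hf
    · obtain rfl : e = f := by simpa using hf
      exact h0
    · exact h k f hf

theorem colors_append {u v : List Event} {Y : ℕ → ℕ → A} :
    Colors (u ++ v) Y ↔ Colors u Y ∧ Colors v fun k => Y (u.length + k) := by
  induction u generalizing Y with
  | nil => simp [colors_nil]
  | cons e u ih =>
    rw [List.cons_append, colors_cons, colors_cons, ih, and_assoc]
    simp only [List.length_cons, add_assoc, add_comm 1]

theorem Colors.congr {w : List Event} {Y Z : ℕ → ℕ → A} (h : Colors w Y)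
    (hZ : ∀ k ≤ w.length, Z k = Y k) : Colors w Z := by
  intro k e hk
  have hlt := (List.getElem?_eq_some_iff.1 hk).1
  rw [hZ k hlt.le, hZ (k + 1) hlt]
  exact h k e hk

theorem Colors.reach {w : List Event} {Y : ℕ → ℕ → A} (h : Colors w Y) :
    Reach w (Y 0) (Y w.length) := by
  induction w generalizing Y with
  | nil => rfl
  | cons e w ih =>
    rw [colors_cons] at h
    exact ⟨Y 1, h.1, ih h.2⟩

theorem Reach.exists_colors {w : List Event} {x z : ℕ → A} (h : Reach w x z) :
    ∃ Y : ℕ → ℕ → A, Colors w Y ∧ Y 0 = x ∧ Y w.length = z := by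
  induction w generalizing x with
  | nil => exact ⟨fun _ => x, colors_nil _, rfl, h⟩
  | cons e w ih =>
    obtain ⟨y, hy, h⟩ := h
    obtain ⟨Y, hY, rfl, rfl⟩ := ih h
    refine ⟨fun k => Nat.casesOn k x Y, colors_cons.2 ⟨hy, hY⟩, rfl, rfl⟩

/-- The coloring of a concatenation that is glued from colorings of its parts. -/
def glue {B : Type*} (n : ℕ) (Y Z : ℕ → ℕ → B) (k : ℕ) : ℕ → B := if k ≤ n then Y k else Z (k - n)

theorem glue_of_le {B : Type*} {n k : ℕ} (h : k ≤ n) (Y Z : ℕ → ℕ → B) : glue n Y Z k = Y k := if_pos h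

theorem glue_add {B : Type*} {n : ℕ} {Y Z : ℕ → ℕ → B} (h : Y n = Z 0) (k : ℕ) : glue n Y Z (n + k) = Z k := by
  rcases Nat.eq_zero_or_pos k with rfl | hk
  · rw [add_zero, glue_of_le le_rfl, h]
  · rw [glue, if_neg (by omega), Nat.add_sub_cancel_left]

theorem Colors.glue {u v : List Event} {Y Z : ℕ → ℕ → A} (hY : Colors u Y) (hZ : Colors v Z)
    (h : Y u.length = Z 0) : Colors (u ++ v) (glue u.length Y Z) := by
  refine colors_append.2 ⟨hY.congr fun k hk => glue_of_le hk _ _, ?_⟩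
  simp only [glue_add h]
  exact hZ

/-- The colorings of the word are determined by their restrictions to the bottom and the top. -/
def Rigid (w : List Event) (A : Type*) [AddCommGroup A] : Prop :=
  ∀ Y Z : ℕ → ℕ → A, Colors w Y → Colors w Z → Y 0 = Z 0 → Y w.length = Z w.length →
    ∀ k ≤ w.length, Y k = Z k

/-- A minimum is the only event that opens a gap whose color is not determined from below. -/
theorem Event.eq_above {e : Event} (he : e.kind ≠ .cup) {x y z : ℕ → A}
    (hy : (x, y) ∈ e.rel A) (hz : (x, z) ∈ e.rel A) : y = z := by
  rcases e with ⟨_ | _ | b, i⟩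
  · exact absurd rfl he
  · have hy := mem_rel_cap.1 hy
    have hz := mem_rel_cap.1 hz
    ext h
    rcases le_total h i with hh | hh
    · rw [← hy.1 h hh, hz.1 h hh]
    · rw [← hy.2 h hh, hz.2 h hh]
  · exact (mem_rel_cross.1 hy).trans (mem_rel_cross.1 hz).symm

theorem Event.mirror_kind_ne_cup {e : Event} (he : e.kind ≠ .cap) : e.mirror.kind ≠ .cup := by
  rcases e with ⟨_ | _ | b, i⟩ <;> simp_all [Event.mirror]

theorem Event.eq_below {e : Event} (he : e.kind ≠ .cap) {x y z : ℕ → A}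
    (hy : (y, x) ∈ e.rel A) (hz : (z, x) ∈ e.rel A) : y = z :=
  Event.eq_above (Event.mirror_kind_ne_cup he) ((mem_rel_mirror e x y).2 hy)
    ((mem_rel_mirror e x z).2 hz)

theorem rigid_of_length_le_one {w : List Event} (h : w.length ≤ 1) : Rigid w A := by
  intro Y Z _ _ h0 h1 k hk
  obtain rfl | rfl : k = 0 ∨ k = w.length := by omega
  · exact h0
  · exact h1

theorem rigid_of_forall_ne_cup {w : List Event} (h : ∀ e ∈ w, e.kind ≠ .cup) : Rigid w A := by
  intro Y Z hY hZ h0 _ k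
  induction k with
  | zero => exact fun _ => h0
  | succ k ih =>
    intro hk
    have hk' : k < w.length := hk
    have h1 := hY k _ (List.getElem?_eq_getElem hk')
    have h2 := hZ k _ (List.getElem?_eq_getElem hk')
    rw [← ih hk'.le] at h2
    exact Event.eq_above (h _ (List.getElem_mem hk')) h1 h2

/-- The middle level is determined from below or from above, unless a minimum is followed by a
maximum. Even then, only a closed circle would hide a gap from both ends, and the two positions
differ. -/
theorem rigid_pair {e f : Event} (h : e.kind ≠ .cup ∨ f.kind ≠ .cap ∨ e.pos ≠ f.pos) :
    Rigid [e, f] A := by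
  intro Y Z hY hZ h0 h2 k hk
  have hY1 := hY 0 e rfl
  have hY2 := hY 1 f rfl
  have hZ1 := hZ 0 e rfl
  have hZ2 := hZ 1 f rfl
  simp only [List.length_cons, List.length_nil, Nat.reduceAdd] at h2 hk hY2 hZ2
  rw [← h0] at hZ1
  rw [← h2] at hZ2
  have h1 : Y 1 = Z 1 := by
    by_cases he : e.kind ≠ .cup
    · exact Event.eq_above he hY1 hZ1
    by_cases hf : f.kind ≠ .cap
    · exact Event.eq_below hf hY2 hZ2
    obtain ⟨a, i⟩ := e
    obtain ⟨b, j⟩ := f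
    have hij : i ≠ j := h.resolve_left he |>.resolve_left hf
    obtain rfl : a = .cup := not_not.1 he
    obtain rfl : b = .cap := not_not.1 hf
    have hY1 := mem_rel_cup.1 hY1
    have hZ1 := mem_rel_cup.1 hZ1
    have hY2 := mem_rel_cap.1 hY2
    have hZ2 := mem_rel_cap.1 hZ2
    ext g
    rcases lt_trichotomy g (i + 1) with hg | rfl | hg
    · rw [hY1.1 g (by omega), hZ1.1 g (by omega)]
    -- The gap inside the minimum is the only one that is invisible from below; as the maximum is at
    -- another position, it passes to the top.
    · rcases Nat.lt_or_ge j i with hj | hj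
      · obtain ⟨m, rfl⟩ := Nat.exists_eq_add_of_lt hj
        rw [show j + m + 1 + 1 = j + m + 2 from rfl, hY2.2 _ (by omega), hZ2.2 _ (by omega)]
      · rw [hY2.1 _ (by omega), hZ2.1 _ (by omega)]
    · obtain ⟨m, rfl⟩ := Nat.exists_eq_add_of_lt hg
      rw [show i + 1 + m + 1 = i + m + 2 by omega, hY1.2 _ (by omega), hZ1.2 _ (by omega)]
  interval_cases k
  · exact h0
  · exact h1
  · exact h2

theorem LocalMove.rigid {s t : List Event} (h : LocalMove s t) :
    Rigid s A ∧ Rigid t A := by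
  cases h with
  | far a b i k =>
    refine ⟨rigid_pair ?_, rigid_pair ?_⟩
    · by_cases ha : a = .cup
      · subst ha
        refine Or.inr (Or.inr ?_)
        simp only [EventKind.tgt]
        omega
      · exact Or.inl ha
    · by_cases ha : a = .cap
      · subst ha
        refine Or.inr (Or.inr ?_)
        simp only [EventKind.src]
        omega
      · exact Or.inr (Or.inl ha)
  | zigzag_left i =>
    exact ⟨rigid_pair (Or.inr (Or.inr (by simp [cup, cap]))), rigid_of_length_le_one (by simp)⟩
  | zigzag_right i =>
    exact ⟨rigid_pair (Or.inr (Or.inr (by simp [cup, cap]))), rigid_of_length_le_one (by simp)⟩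
  | slide_cup i b =>
    exact ⟨rigid_pair (Or.inr (Or.inl (by simp [cross]))),
      rigid_pair (Or.inr (Or.inl (by simp [cross])))⟩
  | slide_cap i b =>
    exact ⟨rigid_pair (Or.inl (by simp [cross])), rigid_pair (Or.inl (by simp [cross]))⟩
  | reidemeister_one_cup i b =>
    exact ⟨rigid_pair (Or.inr (Or.inl (by simp [cross]))), rigid_of_length_le_one (by simp)⟩
  | reidemeister_one_cap i b =>
    exact ⟨rigid_pair (Or.inl (by simp [cross])), rigid_of_length_le_one (by simp)⟩
  | reidemeister_two i b =>
    exact ⟨rigid_pair (Or.inl (by simp [cross])), rigid_of_length_le_one (by simp)⟩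
  | reidemeister_three i a b c h =>
    exact ⟨rigid_of_forall_ne_cup (by simp [cross]), rigid_of_forall_ne_cup (by simp [cross])⟩

/-- The colorings of a word whose bottom level is colored by a member of `I`, extended by zero
beyond the top level. -/
def levelColorings (w : List Event) (I : AddSubgroup (ℕ → A)) : AddSubgroup (ℕ → ℕ → A) where
  carrier := {Y | Y 0 ∈ I ∧ Colors w Y ∧ ∀ k, w.length < k → Y k = 0}
  zero_mem' := ⟨I.zero_mem, fun _ e _ => (e.rel A).zero_mem, fun _ _ => rfl⟩
  add_mem' := fun hY hZ => ⟨I.add_mem hY.1 hZ.1,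
    fun k e he => (e.rel A).add_mem (hY.2.1 k e he) (hZ.2.1 k e he),
    fun k hk => by rw [Pi.add_apply, hY.2.2 k hk, hZ.2.2 k hk, add_zero]⟩
  neg_mem' := fun hY => ⟨I.neg_mem hY.1,
    fun k e he => (e.rel A).neg_mem (hY.2.1 k e he),
    fun k hk => by rw [Pi.neg_apply, hY.2.2 k hk, neg_zero]⟩

/-- The colors on `u` and `v` are kept. The replaced part can be colored because its boundary colors
can be reached, and in only one way because it is rigid. -/
theorem existsUnique_levelColorings_of_replace {u s t v : List Event} (I : AddSubgroup (ℕ → A))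
    (hr : ∀ x z : ℕ → A, Reach s x z → Reach t x z) (ht : Rigid t A)
    (Y : levelColorings (u ++ s ++ v) I) :
    ∃! Z : levelColorings (u ++ t ++ v) I, (∀ k ≤ u.length, Y.1 k = Z.1 k) ∧
      ∀ k, Y.1 (u.length + s.length + k) = Z.1 (u.length + t.length + k) := by
  obtain ⟨Y, hI, hY, h0⟩ := Y
  rw [colors_append, colors_append, List.length_append] at hY
  obtain ⟨⟨hu, hs⟩, hv⟩ := hY
  obtain ⟨T, hT, hT0, hT1⟩ := (hr _ _ hs.reach).exists_colors
  have hglue1 : Y u.length = T 0 := by rw [hT0, add_zero]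
  have hglue2 : glue u.length Y T (u ++ t).length = Y (u.length + s.length + 0) := by
    rw [List.length_append, glue_add hglue1, hT1, add_zero]
  have hlen : (u ++ t).length = u.length + t.length := List.length_append
  refine ⟨⟨glue (u ++ t).length (glue u.length Y T) fun k => Y (u.length + s.length + k),
    ?_, (hu.glue hT hglue1).glue hv hglue2, ?_⟩, ⟨?_, ?_⟩, ?_⟩
  · rw [glue_of_le (Nat.zero_le _), glue_of_le (Nat.zero_le _)]
    exact hI
  · intro k hk
    simp only [List.length_append] at hk h0
    rw [glue, if_neg (by omega)]
    exact h0 _ (by omega)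
  · intro k hk
    simp only
    rw [glue_of_le (by omega), glue_of_le hk]
  · intro k
    simp only
    rw [← hlen, glue_add hglue2]
  · rintro ⟨Z, hZI, hZ, hZ0⟩ ⟨h1, h2⟩
    simp only at h1 h2
    rw [colors_append, colors_append] at hZ
    obtain ⟨⟨-, hZt⟩, -⟩ := hZ
    have hT' := ht _ _ hZt hT (by rw [hT0, add_zero, h1 _ le_rfl]) (by
      have := h2 0
      rw [add_zero, add_zero] at this
      rw [hT1, this])
    ext1
    simp only
    funext k
    rcases Nat.lt_or_ge (u.length + t.length) k with hk | hk
    · obtain ⟨j, rfl⟩ := Nat.exists_eq_add_of_le hk.le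
      conv_rhs => rw [← hlen, glue_add hglue2]
      exact (h2 j).symm
    · rw [glue_of_le (by omega)]
      rcases Nat.lt_or_ge u.length k with hk' | hk'
      · obtain ⟨j, rfl⟩ := Nat.exists_eq_add_of_le hk'.le
        rw [glue_add hglue1]
        exact hT' j (by omega)
      · rw [glue_of_le hk', h1 k hk']

/-- Agreement outside the replaced part is an additive relation, and it is the graph of a bijection.
-/
theorem LocalMove.nonempty_addEquiv {s t : List Event} (h : LocalMove s t) (u v : List Event)
    (I : AddSubgroup (ℕ → A)) :
    Nonempty (levelColorings (u ++ s ++ v) I ≃+ levelColorings (u ++ t ++ v) I) := by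
  let R : AddSubgroup (levelColorings (u ++ s ++ v) I × levelColorings (u ++ t ++ v) I) :=
    { carrier := {p | (∀ k ≤ u.length, p.1.1 k = p.2.1 k) ∧
        ∀ k, p.1.1 (u.length + s.length + k) = p.2.1 (u.length + t.length + k)}
      zero_mem' := ⟨fun _ _ => rfl, fun _ => rfl⟩
      add_mem' := fun hp hq => ⟨fun k hk => congrArg₂ (· + ·) (hp.1 k hk) (hq.1 k hk),
        fun k => congrArg₂ (· + ·) (hp.2 k) (hq.2 k)⟩
      neg_mem' := fun hp => ⟨fun k hk => congrArg (- ·) (hp.1 k hk),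
        fun k => congrArg (- ·) (hp.2 k)⟩ }
  refine AddSubgroup.nonempty_addEquiv_of_existsUnique R (fun Y => ?_) fun Z => ?_
  · exact existsUnique_levelColorings_of_replace I (fun x z => (h.reach_iff x z).1) h.rigid.2 Y
  · have := existsUnique_levelColorings_of_replace I (fun x z => (h.reach_iff x z).2) h.rigid.1 Z
    obtain ⟨Y, hY, hu⟩ := this
    exact ⟨Y, ⟨fun k hk => (hY.1 k hk).symm, fun k => (hY.2 k).symm⟩, fun W hW =>
      hu W ⟨fun k hk => (hW.1 k hk).symm, fun k => (hW.2 k).symm⟩⟩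

end LevelColorings

end ClassicalLink

/-! ### Dehn colorings as level colorings, and link invariance. -/

namespace ClassicalLink

/-- `Event.Joins` ignores the number of strands; under it, gaps of the diagram correspond only to
gaps of the diagram, and the fictitious gaps beyond only to each other. -/
theorem Event.Joins.le_iff {e : Event} {n g h : ℕ} (hj : e.Joins g h) (he : e.Fits n) :
    g ≤ n ↔ h ≤ e.out n := by
  unfold Event.Joins at hj
  unfold Event.Fits at he
  unfold Event.out
  omega

theorem Event.Fits.exists_joins {e : Event} {n h : ℕ} (he : e.Fits n) (hh : e.out n < h) :
    ∃ g, e.Joins g h := by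
  unfold Event.Fits at he
  unfold Event.out at hh
  exact ⟨h + e.kind.src - e.kind.tgt, Or.inr ⟨by omega, by omega⟩⟩

namespace LinkDiagram

variable {A : Type*} [AddCommGroup A] (D : LinkDiagram)

theorem width_zero : D.width 0 = 0 := by simp [width]

theorem width_length : D.width D.word.length = 0 := by
  have key : ∀ (w : List Event) (n m : ℕ), IsTangle w n m →
      w.foldl (fun a f => f.out a) n = m := by
    intro w
    induction w with
    | nil => exact fun n m h => h
    | cons e w ih => exact fun n m h => ih _ _ h.2
  rw [width, List.take_length]
  exact key _ _ _ D.closed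

variable {D}

theorem fits {k : ℕ} {e : Event} (h : D.word[k]? = some e) : e.Fits (D.width k) :=
  D.closed.fits_getElem h

theorem region_eq_of_joins {k g h : ℕ} {e : Event} (he : D.word[k]? = some e)
    (hj : e.Joins g h) (hk : k ≤ D.word.length) (hg : g ≤ D.width k)
    (hk' : k + 1 ≤ D.word.length) (hh : h ≤ D.width (k + 1)) :
    D.region k g hk hg = D.region (k + 1) h hk' hh :=
  Quot.sound ⟨e, he, rfl, hj⟩

theorem lt_length {k : ℕ} {e : Event} (he : D.word[k]? = some e) : k < D.word.length :=
  (List.getElem?_eq_some_iff.1 he).1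

/-- The colors of the gaps, from the colors of the regions; gaps that do not exist have color
zero. -/
def levels (d : D.Region → A) (k g : ℕ) : A :=
  if h : k ≤ D.word.length ∧ g ≤ D.width k then d (D.region k g h.1 h.2) else 0

theorem levels_eq (d : D.Region → A) {k g : ℕ} (hk : k ≤ D.word.length) (hg : g ≤ D.width k) :
    levels d k g = d (D.region k g hk hg) := dif_pos ⟨hk, hg⟩

theorem levels_of_width_lt (d : D.Region → A) {k g : ℕ} (hg : D.width k < g) :
    levels d k g = 0 := dif_neg fun h => by omega

theorem levels_of_joins (d : D.Region → A) {k g h : ℕ} {e : Event} (he : D.word[k]? = some e)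
    (hj : e.Joins g h) : levels d (k + 1) h = levels d k g := by
  have hk := lt_length he
  have hle := hj.le_iff (fits he)
  rw [← D.width_succ he] at hle
  by_cases hg : g ≤ D.width k
  · rw [levels_eq d hk.le hg, levels_eq d hk (hle.1 hg), region_eq_of_joins he hj]
  · rw [levels_of_width_lt d (not_le.1 hg), levels_of_width_lt d (by omega)]

namespace Crossing

theorem levels_left (c : D.Crossing) (d : D.Region → A) : levels d c.level c.pos = d c.left :=
  levels_eq _ _ _

theorem levels_bottom (c : D.Crossing) (d : D.Region → A) :
    levels d c.level (c.pos + 1) = d c.bottom := levels_eq _ _ _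

theorem levels_right (c : D.Crossing) (d : D.Region → A) :
    levels d c.level (c.pos + 2) = d c.right := levels_eq _ _ _

theorem levels_top (c : D.Crossing) (d : D.Region → A) :
    levels d (c.level + 1) (c.pos + 1) = d c.top := levels_eq _ _ _

end Crossing

/-- The level functions that vanish beyond the first gap. -/
def bottomColors (A : Type*) [AddCommGroup A] : AddSubgroup (ℕ → A) where
  carrier := {x | ∀ g, 0 < g → x g = 0}
  zero_mem' := fun _ _ => rfl
  add_mem' := fun hx hy g hg => by rw [Pi.add_apply, hx g hg, hy g hg, add_zero]
  neg_mem' := fun hx g hg => by rw [Pi.neg_apply, hx g hg, neg_zero]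

theorem mem_dehnColorings_iff {d : D.Region → A} :
    d ∈ D.dehnColorings A ↔ ∀ c : D.Crossing,
      d c.top = crossValue c.risingOver (d c.left) (d c.bottom) (d c.right) := by
  refine forall_congr' fun c => ?_
  unfold crossValue
  split_ifs
  · exact eq_sub_iff_add_eq.symm
  · rw [eq_sub_iff_add_eq, add_comm (d c.top), add_comm (d c.right)]

theorem levels_mem_levelColorings {d : D.Region → A} (hd : d ∈ D.dehnColorings A) :
    levels d ∈ levelColorings D.word (bottomColors A) := by
  rw [mem_dehnColorings_iff] at hd
  refine ⟨?_, ?_, ?_⟩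
  · intro g hg
    exact levels_of_width_lt d (by rwa [width_zero])
  · intro k e he
    refine ⟨fun g h hj => levels_of_joins d he hj, ?_⟩
    intro b hb
    obtain ⟨a, i⟩ := e
    obtain rfl : a = .cross b := hb
    have h := hd ⟨k, i, b, he⟩
    simp only [← Crossing.levels_left _ d, ← Crossing.levels_right _ d,
      ← Crossing.levels_bottom _ d, ← Crossing.levels_top _ d] at h
    exact h
  · intro k hk
    funext g
    exact dif_neg fun h => by omega

/-- The fictitious gaps have color zero at the bottom, and each of them at a higher level is carried
up from one below. Level colorings therefore contain no data besides the colors of actual gaps. -/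
theorem eq_zero_of_mem_levelColorings {Y : ℕ → ℕ → A}
    (hY : Y ∈ levelColorings D.word (bottomColors A)) (k g : ℕ) (hg : D.width k < g) :
    Y k g = 0 := by
  induction k generalizing g with
  | zero => exact hY.1 g (by omega)
  | succ k ih =>
    rcases Nat.lt_or_ge k D.word.length with hk | hk
    · have he := List.getElem?_eq_getElem hk
      rw [D.width_succ he] at hg
      obtain ⟨g', hj⟩ := (fits he).exists_joins hg
      refine ((hY.2.1 k _ he).1 g' g hj).trans (ih g' ?_)
      rw [← not_le, hj.le_iff (fits he)]
      omega
    · rw [hY.2.2 (k + 1) (by omega)]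
      rfl

theorem exists_levels_eq {Y : ℕ → ℕ → A} (hY : Y ∈ levelColorings D.word (bottomColors A)) :
    ∃ d ∈ D.dehnColorings A, levels d = Y := by
  let d : D.Region → A := Quot.lift (fun p => Y p.1.1 p.1.2) (by
    rintro ⟨⟨k, g⟩, hk, hg⟩ ⟨⟨l, h⟩, hl, hh⟩ ⟨e, he, hkl, hj⟩
    simp only at he hkl hj
    subst hkl
    exact ((hY.2.1 k e he).1 g h hj).symm)
  have hd : levels d = Y := by
    funext k g
    by_cases hk : k ≤ D.word.length
    · by_cases hg : g ≤ D.width k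
      · rw [levels_eq d hk hg]
        rfl
      · rw [levels_of_width_lt d (by omega), eq_zero_of_mem_levelColorings hY k g (by omega)]
    · rw [hY.2.2 k (by omega)]
      exact dif_neg fun h => by omega
  refine ⟨d, mem_dehnColorings_iff.2 fun c => ?_, hd⟩
  rw [← c.levels_left d, ← c.levels_right d, ← c.levels_bottom d, ← c.levels_top d, hd]
  exact (hY.2.1 c.level _ c.spec).2 c.risingOver rfl

variable (D) in
theorem nonempty_dehnColorings_addEquiv (A : Type*) [AddCommGroup A] :
    Nonempty (D.dehnColorings A ≃+ levelColorings D.word (bottomColors A)) := by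
  let f : D.dehnColorings A →+ levelColorings D.word (bottomColors A) :=
    { toFun := fun d => ⟨levels d.1, levels_mem_levelColorings d.2⟩
      map_zero' := by
        ext k g
        simp [levels]
      map_add' := fun d d' => by
        ext k g
        change levels (d.1 + d'.1) k g = levels d.1 k g + levels d'.1 k g
        unfold levels
        split_ifs <;> simp }
  refine ⟨AddEquiv.ofBijective f ⟨fun d d' h => ?_, fun Y => ?_⟩⟩
  · have h' : levels d.1 = levels d'.1 := congrArg Subtype.val h
    ext R
    induction R using Quot.ind with
    | mk p =>
      have := congrFun (congrFun h' p.1.1) p.1.2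
      rwa [levels_eq _ p.2.1 p.2.2, levels_eq _ p.2.1 p.2.2] at this
  · obtain ⟨d, hd, h⟩ := exists_levels_eq Y.2
    exact ⟨⟨d, hd⟩, Subtype.ext h⟩

theorem Move.nonempty_addEquiv {D E : LinkDiagram} (h : D.Move E) (A : Type*) [AddCommGroup A] :
    Nonempty (D.dehnColorings A ≃+ E.dehnColorings A) := by
  obtain ⟨u, v, s, t, hst, hD, hE⟩ := h
  obtain ⟨f⟩ := D.nonempty_dehnColorings_addEquiv A
  obtain ⟨g⟩ := E.nonempty_dehnColorings_addEquiv A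
  rw [hD] at f
  rw [hE] at g
  obtain ⟨m⟩ := hst.nonempty_addEquiv u v (bottomColors A)
  exact ⟨(f.trans m).trans g.symm⟩

/-- The group of Dehn colorings is a link invariant. -/
theorem nonempty_addEquiv_of_link_eq {D E : LinkDiagram} (h : D.link = E.link) (A : Type*)
    [AddCommGroup A] : Nonempty (D.dehnColorings A ≃+ E.dehnColorings A) := by
  have h' := Quot.eqvGen_exact h
  clear h
  induction h' with
  | rel D E h => exact h.nonempty_addEquiv A
  | refl D => exact ⟨AddEquiv.refl _⟩
  | symm D E _ ih =>
    obtain ⟨f⟩ := ih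
    exact ⟨f.symm⟩
  | trans D E F _ _ ih ih' =>
    obtain ⟨f⟩ := ih
    obtain ⟨g⟩ := ih'
    exact ⟨f.trans g⟩

end LinkDiagram

end ClassicalLink

/-! ### Dehn colorings of connected sums of torus links. -/

namespace ClassicalLink

section TorusSums

/-- The tangle with one strand at the bottom and one at the top whose closure is the torus link
`T_(2,k)`. -/
def torusTangle (k : ℕ) : List Event :=
  cup 1 :: (List.replicate k (cross 0 true) ++ [cap 1])

theorem isTangle_torusTangle (k : ℕ) : IsTangle (torusTangle k) 1 1 := by
  have h : IsTangle (List.replicate k (cross 0 true)) 3 3 := by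
    induction k with
    | zero => rfl
    | succ k ih => exact ⟨by simp [Event.Fits, cross, EventKind.src], ih⟩
  refine ⟨by simp [Event.Fits, cup, EventKind.src], IsTangle.append (m := 3) h ?_⟩
  simp [IsTangle, Event.Fits, Event.out, cap, EventKind.src, EventKind.tgt]

theorem closure_torusTangle (k : ℕ) :
    closure (torusTangle k) (isTangle_torusTangle k) = torusDiagram k := by
  simp [closure, torusTangle, torusDiagram]

/-- The composition of the tangles `torusTangle k`, for `k` in a list. -/
def torusSumTangle : List ℕ → List Event
  | [] => []
  | k :: ks => torusTangle k ++ torusSumTangle ks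

theorem isTangle_torusSumTangle (ks : List ℕ) : IsTangle (torusSumTangle ks) 1 1 := by
  induction ks with
  | nil => rfl
  | cons k ks ih => exact (isTangle_torusTangle k).append ih

theorem isIteratedConnectedSum_torusSum (ks : List ℕ) :
    IsIteratedConnectedSum (ks.map torusLink)
      (closure (torusSumTangle ks) (isTangle_torusSumTangle ks)).link := by
  induction ks with
  | nil => exact .nil
  | cons k ks ih =>
    exact .cons ih ⟨torusTangle k, torusSumTangle ks, isTangle_torusTangle k,
      isTangle_torusSumTangle ks, by rw [closure_torusTangle]; rfl, rfl, rfl⟩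

variable {A : Type*} [AddCommGroup A]

/-- A coloring is cut at the top of `u`: the upper part can be any coloring that starts in `J`, and
the lower part is determined by the colors at the cut together with a parameter `τ` that ranges over
`K`. -/
theorem nonempty_levelColorings_append_addEquiv {u w : List Event} {I J : AddSubgroup (ℕ → A)}
    {T : Type*} [AddCommGroup T] (τ : (ℕ → ℕ → A) →+ T) (K : AddSubgroup T)
    (hτ : ∀ Y Z : ℕ → ℕ → A, (∀ k ≤ u.length, Y k = Z k) → τ Y = τ Z)
    (hJ : ∀ Y : ℕ → ℕ → A, Y 0 ∈ I → Colors u Y → Y u.length ∈ J ∧ τ Y ∈ K)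
    (hex : ∀ z ∈ J, ∀ a ∈ K, ∃ Y : ℕ → ℕ → A, Y 0 ∈ I ∧ Colors u Y ∧ Y u.length = z ∧ τ Y = a)
    (huniq : ∀ Y Z : ℕ → ℕ → A, Y 0 ∈ I → Colors u Y → Z 0 ∈ I → Colors u Z →
      Y u.length = Z u.length → τ Y = τ Z → ∀ k ≤ u.length, Y k = Z k) :
    Nonempty (levelColorings (u ++ w) I ≃+ K × levelColorings w J) := by
  let R : AddSubgroup (levelColorings (u ++ w) I × (K × levelColorings w J)) :=
    { carrier := {p | τ p.1.1 = p.2.1.1 ∧ ∀ k, p.1.1 (u.length + k) = p.2.2.1 k}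
      zero_mem' := ⟨τ.map_zero, fun _ => rfl⟩
      add_mem' := fun {p q} hp hq => ⟨(τ.map_add p.1.1 q.1.1).trans
        (congrArg₂ (· + ·) hp.1 hq.1), fun k => congrArg₂ (· + ·) (hp.2 k) (hq.2 k)⟩
      neg_mem' := fun {p} hp => ⟨(τ.map_neg p.1.1).trans (congrArg (- ·) hp.1),
        fun k => congrArg (- ·) (hp.2 k)⟩ }
  refine AddSubgroup.nonempty_addEquiv_of_existsUnique R ?_ ?_
  · rintro ⟨Y, hI, hY, h0⟩
    rw [colors_append] at hY
    obtain ⟨h1, h2⟩ := hJ Y hI hY.1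
    refine ⟨⟨⟨τ Y, h2⟩, ⟨fun k => Y (u.length + k), h1, hY.2, fun k hk => h0 _ ?_⟩⟩,
      ⟨rfl, fun k => rfl⟩, ?_⟩
    · rw [List.length_append]
      omega
    · rintro ⟨⟨a, ha⟩, ⟨Z, hZ⟩⟩ ⟨h3, h4⟩
      obtain rfl : τ Y = a := h3
      obtain rfl : (fun k => Y (u.length + k)) = Z := funext h4
      rfl
  · rintro ⟨⟨a, ha⟩, ⟨Z, hZI, hZ, h0⟩⟩
    obtain ⟨Y, hI, hY, hYZ, rfl⟩ := hex _ hZI a ha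
    refine ⟨⟨glue u.length Y Z, ?_, hY.glue hZ hYZ, ?_⟩, ⟨?_, fun k => glue_add hYZ k⟩, ?_⟩
    · rwa [glue_of_le (Nat.zero_le _)]
    · intro k hk
      rw [List.length_append] at hk
      obtain ⟨j, rfl⟩ := Nat.exists_eq_add_of_le (show u.length ≤ k by omega)
      rw [glue_add hYZ]
      exact h0 _ (by omega)
    · exact hτ _ _ fun k hk => glue_of_le hk _ _
    · rintro ⟨X, hXI, hX, hX0⟩ ⟨h3, h4⟩
      simp only at h3 h4
      rw [colors_append] at hX
      have h5 := huniq X Y hXI hX.1 hI hY (by rw [hYZ, ← h4 0, add_zero]) h3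
      ext1
      simp only
      funext k
      rcases le_total k u.length with hk | hk
      · rw [h5 k hk, glue_of_le hk]
      · obtain ⟨j, rfl⟩ := Nat.exists_eq_add_of_le hk
        rw [h4, glue_add hYZ]

/-- The level functions with colors `a, b, a`, and zero beyond. -/
def arcColors (A : Type*) [AddCommGroup A] : AddSubgroup (ℕ → A) where
  carrier := {x | x 2 = x 0 ∧ ∀ g, 2 < g → x g = 0}
  zero_mem' := ⟨rfl, fun _ _ => rfl⟩
  add_mem' := fun hx hy => ⟨congrArg₂ (· + ·) hx.1 hy.1, fun g hg => by
    rw [Pi.add_apply, hx.2 g hg, hy.2 g hg, add_zero]⟩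
  neg_mem' := fun hx => ⟨congrArg (- ·) hx.1, fun g hg => by
    rw [Pi.neg_apply, hx.2 g hg, neg_zero]⟩

/-- The outer gaps `0` and `2` are never changed, so each crossing adds the same difference to the
gap `1`. -/
theorem iterate_crossFun (x : ℕ → A) (j : ℕ) :
    (crossFun 0 true)^[j] x = Function.update x 1 (x 1 + j • (x 0 - x 2)) := by
  induction j with
  | zero => simp
  | succ j ih =>
    rw [Function.iterate_succ_apply', ih]
    ext h
    by_cases hh : h = 1
    · subst hh
      rw [crossFun_of_eq rfl]
      simp [crossValue, succ_nsmul]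
      abel
    · rw [crossFun_of_ne hh]
      simp [hh]

theorem colors_replicate_cross {k : ℕ} {Y : ℕ → ℕ → A} :
    Colors (List.replicate k (cross 0 true)) Y ↔
      ∀ j ≤ k, Y j = (crossFun 0 true)^[j] (Y 0) := by
  constructor
  · intro h j
    induction j with
    | zero => exact fun _ => rfl
    | succ j ih =>
      intro hj
      have h1 := h j (cross 0 true) (by rw [List.getElem?_replicate_of_lt (by omega)])
      rw [mem_rel_cross, ih (by omega)] at h1
      rw [h1, Function.iterate_succ_apply']
  · intro h j e he
    rw [List.getElem?_replicate] at he
    split_ifs at he with hj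
    obtain rfl : cross 0 true = e := by simpa using he
    rw [mem_rel_cross, h (j + 1) hj, h j hj.le, Function.iterate_succ_apply']

theorem colors_torusTangle {k : ℕ} {Y : ℕ → ℕ → A} :
    Colors (torusTangle k) Y ↔ (Y 0, Y 1) ∈ (cup 1).rel A ∧
      (∀ j ≤ k, Y (j + 1) = (crossFun 0 true)^[j] (Y 1)) ∧
        (Y (k + 1), Y (k + 2)) ∈ (cap 1).rel A := by
  rw [torusTangle, colors_cons, colors_append, colors_replicate_cross, colors_cons]
  simp only [colors_nil, and_true, List.length_replicate]

theorem length_torusTangle (k : ℕ) : (torusTangle k).length = k + 2 := by simp [torusTangle]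

/-- The elements of `A` that are annihilated by `k`. -/
def torsionBy (A : Type*) [AddCommGroup A] (k : ℕ) : AddSubgroup A :=
  (nsmulAddMonoidHom k : A →+ A).ker

/-- The minimum creates one free color, that of the gap `2`, and the crossings add `k • (Y 0 0 - Y 1
2)` to the gap `1`. The maximum identifies the gap `1` with the gap `3`, whose color is still `Y 0
1`; this yields the torsion condition. -/
theorem colors_torusTangle_top {k : ℕ} {Y : ℕ → ℕ → A} (hY : Colors (torusTangle k) Y) :
    Y 1 = (fun g => if g ≤ 1 then Y 0 g else if g = 2 then Y 1 2 else Y 0 (g - 2)) ∧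
      Y (k + 2) = Y 0 ∧ k • (Y 0 0 - Y 1 2) = 0 := by
  obtain ⟨h1, h2, h3⟩ := colors_torusTangle.1 hY
  rw [mem_rel_cup] at h1
  rw [h2 k le_rfl, iterate_crossFun, mem_rel_cap] at h3
  have e1 : Y 1 = (fun g => if g ≤ 1 then Y 0 g else if g = 2 then Y 1 2 else Y 0 (g - 2)) := by
    funext g
    split_ifs with hg hg'
    · exact h1.1 g hg
    · rw [hg']
    · obtain ⟨j, rfl⟩ := Nat.exists_eq_add_of_le (show 3 ≤ g by omega)
      rw [show 3 + j = 1 + j + 2 by omega, h1.2 _ (by omega)]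
      rfl
  have a0 := h1.1 0 (by omega)
  have a1 := h1.1 1 le_rfl
  have a3 := h1.2 1 le_rfl
  have b0 := h3.1 0 (by omega)
  have b1 := h3.1 1 le_rfl
  have b2 := h3.2 1 le_rfl
  simp [a0, a1] at b0 b1
  simp [a3] at b2
  refine ⟨e1, ?_, ?_⟩
  · funext g
    rcases Nat.lt_or_ge g 1 with hg | hg
    · obtain rfl : g = 0 := by omega
      exact b0.symm
    · have h4 := h3.2 g hg
      rw [Function.update_of_ne (by omega), h1.2 g hg] at h4
      exact h4.symm
  · rw [← b2] at b1
    simpa using b1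

theorem exists_colors_torusTangle {k : ℕ} (z : ℕ → A) {a : A} (ha : k • a = 0) : ∃ Y : ℕ → ℕ → A, Y 0 = z ∧ Colors (torusTangle k) Y ∧ Y (k + 2) = z ∧
      Y 0 0 - Y 1 2 = a := by
  -- The free color is chosen so that the parameter `Y 0 0 - Y 1 2` equals `a`.
  let y : ℕ → A := fun g => if g ≤ 1 then z g else if g = 2 then z 0 - a else z (g - 2)
  have hy : (z, y) ∈ (cup 1).rel A := by
    rw [mem_rel_cup]
    refine ⟨fun h hh => if_pos hh, fun h hh => ?_⟩
    simp only [y]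
    rw [if_neg (by omega), if_neg (by omega)]
    rfl
  have hk : (crossFun 0 true)^[k] y = y := by
    rw [iterate_crossFun]
    simp [y, ha]
  refine ⟨fun m => if m = 0 ∨ m = k + 2 then z else (crossFun 0 true)^[m - 1] y, by simp,
    colors_torusTangle.2 ⟨by simpa using hy, ?_, ?_⟩, by simp, by simp [y]⟩
  · intro j hj
    simp [show j ≠ k + 1 by omega]
  · simp only [Nat.add_eq_zero_iff, one_ne_zero, and_false, Nat.add_left_cancel_iff, false_or,
      Nat.reduceEqDiff, if_false, Nat.add_sub_cancel, hk, or_true, if_true]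
    exact (mem_rel_mirror (cup 1) y z).2 hy

/-- The tangle has equal colors at its two ends, and its one parameter `Y 0 0 - Y 1 2` ranges over
the `k`-torsion. -/
theorem nonempty_torusTangle_append_addEquiv (k : ℕ) (w : List Event) :
    Nonempty (levelColorings (torusTangle k ++ w) (arcColors A) ≃+
      torsionBy A k × levelColorings w (arcColors A)) := by
  refine nonempty_levelColorings_append_addEquiv
    { toFun := fun Y => Y 0 0 - Y 1 2
      map_zero' := sub_zero _
      map_add' := fun Y Z => add_sub_add_comm _ _ _ _ } _ ?_ ?_ ?_ ?_
  · intro Y Z h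
    simp only [AddMonoidHom.coe_mk, ZeroHom.coe_mk]
    rw [h 0 (Nat.zero_le _), h 1 (by rw [length_torusTangle]; omega)]
  · intro Y h0 hY
    obtain ⟨-, h1, h2⟩ := colors_torusTangle_top hY
    rw [length_torusTangle, h1]
    exact ⟨h0, h2⟩
  · intro z hz a ha
    obtain ⟨Y, h0, h1, h2, h3⟩ := exists_colors_torusTangle (k := k) z ha
    exact ⟨Y, h0 ▸ hz, h1, by rw [length_torusTangle, h2], h3⟩
  · intro Y Z _ hY _ hZ htop hτ
    simp only [AddMonoidHom.coe_mk, ZeroHom.coe_mk] at hτ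
    obtain ⟨y1, y2, -⟩ := colors_torusTangle_top hY
    obtain ⟨z1, z2, -⟩ := colors_torusTangle_top hZ
    rw [length_torusTangle] at htop ⊢
    have h0 : Y 0 = Z 0 := by rw [← y2, ← z2, htop]
    have h12 : Y 1 2 = Z 1 2 := by
      rw [h0] at hτ
      exact sub_right_injective hτ
    have h1 : Y 1 = Z 1 := by rw [y1, z1, h0, h12]
    intro j hj
    rcases Nat.eq_zero_or_pos j with rfl | hj0
    · exact h0
    rcases Nat.lt_or_ge j (k + 2) with hj2 | hj2
    · obtain ⟨i, rfl⟩ := Nat.exists_eq_add_of_lt hj0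
      rw [zero_add, (colors_torusTangle.1 hY).2.1 i (by omega),
        (colors_torusTangle.1 hZ).2.1 i (by omega), h1]
    · obtain rfl : j = k + 2 := by omega
      exact htop

/-- The colors below a minimum are determined by those above it, so there is no additional
parameter: `τ` is zero and `K` is trivial. -/
theorem nonempty_cup_append_addEquiv (w : List Event) :
    Nonempty (levelColorings (cup 0 :: w) (LinkDiagram.bottomColors A) ≃+
      levelColorings w (arcColors A)) := by
  have h := nonempty_levelColorings_append_addEquiv (u := [cup 0]) (w := w)
    (I := LinkDiagram.bottomColors A) (J := arcColors A) (T := A) 0 ⊥ (fun _ _ _ => rfl) ?_ ?_ ?_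
  · obtain ⟨f⟩ := h
    exact ⟨f.trans AddEquiv.uniqueProd⟩
  · intro Y h0 hY
    have h1 := mem_rel_cup.1 (hY 0 _ rfl)
    refine ⟨⟨?_, fun g hg => ?_⟩, AddSubgroup.zero_mem _⟩
    · exact (h1.2 0 le_rfl).trans (h1.1 0 le_rfl).symm
    · obtain ⟨j, rfl⟩ := Nat.exists_eq_add_of_lt hg
      have h2 := h1.2 (j + 1) (by omega)
      rw [h0 (j + 1) (by omega)] at h2
      rw [← h2]
      change Y 1 _ = Y 1 _
      congr 1
      omega
  · intro z hz a ha
    refine ⟨fun m => if m = 0 then fun g => if g = 0 then z 0 else 0 else z, ?_, ?_, by simp,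
      ha.symm⟩
    · intro g hg
      simp [hg.ne']
    · refine colors_cons.2 ⟨mem_rel_cup.2 ⟨fun h hh => ?_, fun h hh => ?_⟩, colors_nil _⟩
      · obtain rfl : h = 0 := by omega
        simp
      · by_cases h0 : h = 0
        · subst h0
          simpa using hz.1
        · simpa [h0] using hz.2 (h + 2) (by omega)
  · intro Y Z _ hY _ hZ htop _ k hk
    have hk : k ≤ 1 := hk
    have htop : Y 1 = Z 1 := htop
    interval_cases k
    · have h1 := hY 0 _ rfl
      have h2 := hZ 0 _ rfl
      rw [zero_add, ← htop] at h2
      exact Event.eq_below (by simp [cup]) h1 h2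
    · exact htop

/-- Below the last maximum there are two strands and two free colors, that of the gap between the
strands and the common one of the gaps outside. -/
theorem nonempty_cap_addEquiv :
    Nonempty (levelColorings [cap 0] (arcColors A) ≃+ A × A) := by
  let R : AddSubgroup (levelColorings [cap 0] (arcColors A) × (A × A)) :=
    { carrier := {p | p.1.1 0 0 = p.2.1 ∧ p.1.1 0 1 = p.2.2}
      zero_mem' := ⟨rfl, rfl⟩
      add_mem' := fun hp hq => ⟨congrArg₂ (· + ·) hp.1 hq.1, congrArg₂ (· + ·) hp.2 hq.2⟩
      neg_mem' := fun hp => ⟨congrArg (- ·) hp.1, congrArg (- ·) hp.2⟩ }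
  refine AddSubgroup.nonempty_addEquiv_of_existsUnique R ?_ ?_
  · intro Y
    exact ⟨(Y.1 0 0, Y.1 0 1), ⟨rfl, rfl⟩, fun p hp => Prod.ext hp.1.symm hp.2.symm⟩
  · rintro ⟨a, b⟩
    let x : ℕ → A := fun g => if g = 0 ∨ g = 2 then a else if g = 1 then b else 0
    let y : ℕ → A := fun g => if g = 0 then a else 0
    refine ⟨⟨fun k => if k = 0 then x else if k = 1 then y else 0, ⟨by simp [x], ?_⟩, ?_, ?_⟩,
      ⟨by simp [x], by simp [x]⟩, ?_⟩
    · intro g hg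
      simp [x, show g ≠ 0 by omega, show g ≠ 2 by omega, show g ≠ 1 by omega]
    · refine colors_cons.2 ⟨mem_rel_cap.2 ⟨fun h hh => ?_, fun h hh => ?_⟩, colors_nil _⟩
      · obtain rfl : h = 0 := by omega
        simp [x, y]
      · simp [x, y]
    · intro k hk
      have hk : 1 < k := hk
      simp [show k ≠ 0 by omega, show k ≠ 1 by omega]
    · rintro ⟨Y, hI, hY, h0⟩ ⟨ha, hb⟩
      obtain rfl : Y 0 0 = a := ha
      obtain rfl : Y 0 1 = b := hb
      ext1
      have h1 := mem_rel_cap.1 (hY 0 _ rfl)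
      simp only
      funext k g
      by_cases hk : k = 0
      · subst hk
        by_cases hg : g = 0
        · simp [x, hg]
        by_cases hg1 : g = 1
        · simp [x, hg1]
        by_cases hg2 : g = 2
        · simpa [x, hg2] using hI.1
        · simpa [x, hg, hg1, hg2] using hI.2 g (by omega)
      by_cases hk1 : k = 1
      · subst hk1
        by_cases hg : g = 0
        · subst hg
          simpa [y] using (h1.1 0 le_rfl).symm
        · have h2 := h1.2 g (Nat.zero_le _)
          rw [hI.2 (g + 2) (by omega)] at h2
          simpa [y, hg] using h2.symm
      · have h2 := h0 k (by change 1 < k; omega)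
        simp [hk, hk1, h2]

theorem nonempty_torsionPi_cons_addEquiv {r : ℕ} (k : Fin (r + 1) → ℕ) :
    Nonempty (torsionPi k A ≃+ torsionBy A (k 0) × torsionPi (fun j => k j.succ) A) :=
  ⟨{ toFun := fun v => (⟨v.1 0, v.2 0⟩, ⟨fun j => v.1 j.succ, fun j => v.2 j.succ⟩)
     invFun := fun w => ⟨Fin.cons w.1.1 w.2.1, fun j => by
      cases j using Fin.cases with
      | zero => exact w.1.2
      | succ j => exact w.2.2 j⟩
     left_inv := fun v => by
      ext j
      cases j using Fin.cases <;> simp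
     right_inv := fun w => by
      ext j <;> simp
     map_add' := fun v w => rfl }⟩

theorem nonempty_torusSumTangle_append_addEquiv (ks : List ℕ) :
    Nonempty (levelColorings (torusSumTangle ks ++ [cap 0]) (arcColors A) ≃+
      torsionPi ks.get A × (A × A)) := by
  induction ks with
  | nil =>
    obtain ⟨f⟩ := nonempty_cap_addEquiv (A := A)
    have : Unique (torsionPi [].get A) :=
      { default := 0
        uniq := fun v => by
          ext i
          exact i.elim0 }
    exact ⟨f.trans AddEquiv.uniqueProd.symm⟩
  | cons k ks ih =>
    obtain ⟨f⟩ := nonempty_torusTangle_append_addEquiv (A := A) k (torusSumTangle ks ++ [cap 0])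
    obtain ⟨g⟩ := ih
    obtain ⟨h⟩ := nonempty_torsionPi_cons_addEquiv (A := A) (k :: ks).get
    rw [torusSumTangle, List.append_assoc]
    exact ⟨(f.trans ((AddEquiv.refl _).prodCongr g)).trans
      (AddEquiv.prodAssoc.symm.trans (h.symm.prodCongr (AddEquiv.refl _)))⟩

theorem nonempty_dehnColorings_torusSum_addEquiv (ks : List ℕ) :
    Nonempty ((closure (torusSumTangle ks) (isTangle_torusSumTangle ks)).dehnColorings A ≃+
      torsionPi ks.get A × (A × A)) := by
  obtain ⟨f⟩ := (closure (torusSumTangle ks)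
    (isTangle_torusSumTangle ks)).nonempty_dehnColorings_addEquiv A
  obtain ⟨g⟩ := nonempty_cup_append_addEquiv (A := A) (torusSumTangle ks ++ [cap 0])
  obtain ⟨h⟩ := nonempty_torusSumTangle_append_addEquiv (A := A) ks
  exact ⟨f.trans (g.trans h)⟩

end TorusSums

end ClassicalLink

/-- On a finite directed graph there is a flow with prescribed divergence, provided that the
divergences in each connected component sum up to zero. -/
theorem exists_flow_of_sum_eq_zero {V A : Type*} [Fintype V] [DecidableEq V] [AddCommGroup A]
    (r : V → V → Prop) [DecidableEq (Quot r)] (b : V → A)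
    (hb : ∀ q : Quot r, ∑ v, (if Quot.mk r v = q then b v else 0) = 0) :
    ∃ x : V → V → A, (∀ v w, ¬ r v w → x v w = 0) ∧
      ∀ v, ∑ w, x v w - ∑ w, x w v = b v := by
  -- The divergences of flows form a subgroup, so it is enough to realize those supported at the two
  -- ends of a path.
  let S : AddSubgroup (V → A) :=
    { carrier := {b | ∃ x : V → V → A, (∀ v w, ¬ r v w → x v w = 0) ∧
        ∀ v, ∑ w, x v w - ∑ w, x w v = b v}
      zero_mem' := ⟨fun _ _ => 0, fun _ _ _ => rfl, fun _ => by simp⟩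
      add_mem' := by
        rintro b b' ⟨x, hx, hxb⟩ ⟨y, hy, hyb⟩
        refine ⟨fun v w => x v w + y v w, fun v w h => by simp only [hx v w h, hy v w h, add_zero],
          fun v => ?_⟩
        rw [Finset.sum_add_distrib, Finset.sum_add_distrib, add_sub_add_comm, hxb, hyb]
        rfl
      neg_mem' := by
        rintro b ⟨x, hx, hxb⟩
        refine ⟨fun v w => -x v w, fun v w h => by simp only [hx v w h, neg_zero], fun v => ?_⟩
        rw [Finset.sum_neg_distrib, Finset.sum_neg_distrib, Pi.neg_apply, ← hxb]
        abel }
  change b ∈ S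
  have hedge : ∀ v w, r v w → ∀ a : A, Pi.single v a - Pi.single w a ∈ S := by
    intro v w hvw a
    refine ⟨Pi.single v (Pi.single w a), fun v' w' h => ?_, fun u => ?_⟩
    · by_cases hv : v' = v
      · subst hv
        by_cases hw : w' = w
        · subst hw
          exact absurd hvw h
        · simp [hw]
      · simp [hv]
    · rw [Pi.sub_apply]
      congr 1
      · by_cases hu : u = v
        · subst hu
          simp
        · simp [hu]
      · rw [Finset.sum_eq_single v]
        · simp [Pi.single_apply]
        · intro u' _ hu
          simp [hu]
        · simp
  have hpath : ∀ v w, Relation.EqvGen r v w → ∀ a : A, Pi.single v a - Pi.single w a ∈ S := by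
    intro v w h
    induction h with
    | rel v w h => exact hedge v w h
    | refl v =>
      intro a
      rw [sub_self]
      exact S.zero_mem
    | symm v w _ ih =>
      intro a
      rw [← neg_sub]
      exact S.neg_mem (ih a)
    | trans u v w _ _ ih ih' =>
      intro a
      rw [← sub_add_sub_cancel _ (Pi.single v a)]
      exact S.add_mem (ih a) (ih' a)
  -- Every `b v` is transported to the chosen representative of its class; what accumulates there is
  -- zero by `hb`.
  have hsum : b = ∑ v, (Pi.single v (b v) - Pi.single (Quot.mk r v).out (b v)) := by
    rw [Finset.sum_sub_distrib, Finset.univ_sum_single]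
    have h0 : ∑ v, Pi.single (M := fun _ => A) (Quot.mk r v).out (b v) = 0 := by
      ext w
      rw [Finset.sum_apply, Pi.zero_apply]
      by_cases hw : (Quot.mk r w).out = w
      · rw [← hb (Quot.mk r w)]
        refine Finset.sum_congr rfl fun v _ => ?_
        rw [Pi.single_apply]
        by_cases hv : Quot.mk r v = Quot.mk r w
        · rw [if_pos hv, hv, if_pos hw.symm]
        · rw [if_neg hv, if_neg]
          rintro rfl
          exact hv (Quot.out_eq _).symm
      · refine Finset.sum_eq_zero fun v _ => ?_
        rw [Pi.single_apply, if_neg]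
        rintro rfl
        exact hw (by rw [Quot.out_eq])
    rw [h0, sub_zero]
  rw [hsum]
  exact S.sum_mem fun v _ => hpath _ _ (Quot.eqvGen_exact (Quot.out_eq _).symm) _

/-! ### Corners of crossings, and the Goeritz matrix as an operator on colorings. -/

namespace ClassicalLink

namespace LinkDiagram

variable {D : LinkDiagram}

noncomputable instance : Fintype D.Gap := Fintype.ofFinite _

namespace Crossing

variable (c : D.Crossing)

/-- The four gaps next to a crossing. -/
def gapLeft : D.Gap := ⟨(c.level, c.pos), c.level_lt.le, by have := c.pos_le; simp only; omega⟩

def gapBottom : D.Gap :=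
  ⟨(c.level, c.pos + 1), c.level_lt.le, by have := c.pos_le; simp only; omega⟩

def gapRight : D.Gap := ⟨(c.level, c.pos + 2), c.level_lt.le, c.pos_le⟩

def gapTop : D.Gap :=
  ⟨(c.level + 1, c.pos + 1), c.level_lt, by have := c.pos_le_succ; simp only; omega⟩

/-- The gap above the crossing that belongs to the region on its left. -/
def gapLeftAbove : D.Gap :=
  ⟨(c.level + 1, c.pos), c.level_lt, by have := c.pos_le_succ; simp only; omega⟩

theorem gapJoined_left : D.GapJoined c.gapLeft c.gapLeftAbove :=
  ⟨_, c.spec, rfl, Or.inl ⟨le_rfl, rfl⟩⟩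

theorem eq_of_level_eq {c c' : D.Crossing} (h : c.level = c'.level) : c = c' := by
  obtain ⟨k, i, b, hk⟩ := c
  obtain ⟨l, j, b', hl⟩ := c'
  obtain rfl : k = l := h
  rw [hk] at hl
  simp only [cross, Option.some.injEq, Event.mk.injEq, EventKind.cross.injEq] at hl
  obtain ⟨rfl, rfl⟩ := hl
  rfl

variable (σ : D.Shading)

theorem shaded_left : σ.shaded c.left = !σ.shaded c.bottom := by
  have h := σ.alternate c.level c.pos c.level_lt.le (by have := c.pos_le; omega)
  exact Bool.eq_not_of_ne h

theorem shaded_right : σ.shaded c.right = !σ.shaded c.bottom := by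
  have h := σ.alternate c.level (c.pos + 1) c.level_lt.le c.pos_le
  exact Bool.eq_not_of_ne h.symm

theorem shaded_top : σ.shaded c.top = σ.shaded c.bottom := by
  have h := σ.alternate (c.level + 1) c.pos c.level_lt (by have := c.pos_le_succ; omega)
  have hl : c.left = Quot.mk _ c.gapLeftAbove := Quot.sound c.gapJoined_left
  have h' : σ.shaded c.left ≠ σ.shaded c.top := by
    rw [hl]
    exact h
  rw [c.shaded_left] at h'
  revert h'
  cases σ.shaded c.top <;> cases σ.shaded c.bottom <;> simp

end Crossing

variable {A : Type*} [AddCommGroup A] (σ : D.Shading)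

namespace Shading

/-- The two unshaded corners of a crossing. -/
def unshadedFst (c : D.Crossing) : D.Region := if σ.shaded c.bottom then c.left else c.bottom

def unshadedSnd (c : D.Crossing) : D.Region := if σ.shaded c.bottom then c.right else c.top

theorem shaded_unshadedFst (c : D.Crossing) : σ.shaded (σ.unshadedFst c) = false := by
  unfold unshadedFst
  split_ifs with h
  · rw [c.shaded_left, h]
    rfl
  · simpa using h

theorem shaded_unshadedSnd (c : D.Crossing) : σ.shaded (σ.unshadedSnd c) = false := by
  unfold unshadedSnd
  split_ifs with h
  · rw [c.shaded_right, h]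
    rfl
  · rw [c.shaded_top]
    simpa using h

theorem incident_iff_of_unshaded (c : D.Crossing) {R : D.Region} (hR : σ.shaded R = false) :
    c.Incident R ↔ R = σ.unshadedFst c ∨ R = σ.unshadedSnd c := by
  unfold Crossing.Incident unshadedFst unshadedSnd
  have hl := c.shaded_left σ
  have hr := c.shaded_right σ
  have ht := c.shaded_top σ
  split_ifs with h
  · constructor
    · rintro (rfl | rfl | rfl | rfl) <;> simp_all
    · tauto
  · constructor
    · rintro (rfl | rfl | rfl | rfl) <;> simp_all
    · tauto

open scoped Classical in
/-- The Goeritz matrix applied to a coloring of the regions. -/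
noncomputable def curl (d : D.Region → A) (R : D.Region) : A :=
  ∑ c, σ.goeritzIndex c •
    ((if σ.unshadedFst c = R then d (σ.unshadedFst c) - d (σ.unshadedSnd c) else 0) +
      if σ.unshadedSnd c = R then d (σ.unshadedSnd c) - d (σ.unshadedFst c) else 0)

theorem curl_eq_zero_of_shaded (d : D.Region → A) {R : D.Region} (hR : σ.shaded R = true) :
    σ.curl d R = 0 := by
  refine Finset.sum_eq_zero fun c _ => ?_
  rw [if_neg, if_neg, add_zero, smul_zero]
  · rintro rfl
    rw [shaded_unshadedSnd] at hR
    exact absurd hR (by simp)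
  · rintro rfl
    rw [shaded_unshadedFst] at hR
    exact absurd hR (by simp)

/-- The diagonal entries make the row sums vanish, so only differences `d V - d U` occur; the sum is
then regrouped by crossings. -/
theorem sum_goeritz_smul (d : D.Region → A) (U : σ.Unshaded) :
    ∑ V, σ.goeritz U V • d V.1 = σ.curl d U.1 := by
  classical
  have h1 : ∑ V, σ.goeritz U V • d V.1 =
      ∑ V with V ≠ U, σ.goeritzEntry U V • (d V.1 - d U.1) := by
    rw [← Finset.add_sum_erase _ _ (Finset.mem_univ U)]
    have h2 : σ.goeritz U U = -∑ W : σ.Unshaded with W ≠ U, σ.goeritzEntry U W := by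
      simp [goeritz]
    rw [h2, neg_smul, Finset.sum_smul, Finset.filter_ne' , ← Finset.sum_neg_distrib,
      ← Finset.sum_add_distrib]
    refine Finset.sum_congr rfl fun V hV => ?_
    have h3 : σ.goeritz U V = σ.goeritzEntry U V := by
      simp [goeritz, (Finset.ne_of_mem_erase hV).symm]
    rw [h3, smul_sub]
    abel
  have h2 : ∀ V, σ.goeritzEntry U V • (d V.1 - d U.1) =
      ∑ c, σ.goeritzIndex c • if c.Incident U.1 ∧ c.Incident V.1 then d U.1 - d V.1 else 0 := by
    intro V
    rw [goeritzEntry, neg_smul, ← smul_neg, neg_sub, Finset.sum_smul, Finset.sum_filter]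
    exact Finset.sum_congr rfl fun c _ => by split_ifs <;> simp
  rw [h1]
  simp only [h2]
  rw [Finset.sum_comm]
  refine Finset.sum_congr rfl fun c _ => ?_
  rw [← Finset.smul_sum]
  congr 1
  have hinc : ∀ V : σ.Unshaded, c.Incident V.1 ↔
      V.1 = σ.unshadedFst c ∨ V.1 = σ.unshadedSnd c := fun V =>
    σ.incident_iff_of_unshaded c V.2
  simp only [hinc]
  set X : σ.Unshaded := ⟨σ.unshadedFst c, σ.shaded_unshadedFst c⟩ with hX
  set Z : σ.Unshaded := ⟨σ.unshadedSnd c, σ.shaded_unshadedSnd c⟩ with hZ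
  have e1 : ∀ V : σ.Unshaded, V.1 = σ.unshadedFst c ↔ V = X := fun V =>
    ⟨fun h => Subtype.ext h, fun h => congrArg Subtype.val h⟩
  have e2 : ∀ V : σ.Unshaded, V.1 = σ.unshadedSnd c ↔ V = Z := fun V =>
    ⟨fun h => Subtype.ext h, fun h => congrArg Subtype.val h⟩
  rw [eq_comm (a := σ.unshadedFst c), eq_comm (a := σ.unshadedSnd c)]
  simp only [e1, e2]
  change _ = (if U = X then d X.1 - d Z.1 else 0) + if U = Z then d Z.1 - d X.1 else 0
  by_cases hUX : U = X
  · by_cases hUZ : U = Z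
    -- A crossing whose two unshaded corners belong to the same region: its two terms in `curl`
    -- cancel, and it contributes to no off-diagonal entry.
    · rw [if_pos hUX, if_pos hUZ, sub_add_sub_cancel, sub_self]
      refine Finset.sum_eq_zero fun V hV => if_neg ?_
      rw [Finset.mem_filter] at hV
      rintro ⟨-, h | h⟩
      · exact hV.2 (h.trans hUX.symm)
      · exact hV.2 (h.trans hUZ.symm)
    · rw [if_pos hUX, if_neg hUZ, add_zero, Finset.sum_eq_single Z]
      · rw [if_pos ⟨Or.inl hUX, Or.inr rfl⟩, hUX]
      · intro V hV hVZ
        rw [Finset.mem_filter] at hV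
        refine if_neg ?_
        rintro ⟨-, h | h⟩
        · exact hV.2 (h.trans hUX.symm)
        · exact hVZ h
      · intro h
        exact absurd (by simpa using Ne.symm hUZ) h
  · by_cases hUZ : U = Z
    · rw [if_neg hUX, if_pos hUZ, zero_add, Finset.sum_eq_single X]
      · rw [if_pos ⟨Or.inr hUZ, Or.inl rfl⟩, hUZ]
      · intro V hV hVZ
        rw [Finset.mem_filter] at hV
        refine if_neg ?_
        rintro ⟨-, h | h⟩
        · exact hVZ h
        · exact hV.2 (h.trans hUZ.symm)
      · intro h
        exact absurd (by simpa using Ne.symm hUX) h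
    · rw [if_neg hUX, if_neg hUZ, add_zero]
      refine Finset.sum_eq_zero fun V _ => if_neg ?_
      rintro ⟨h | h, -⟩
      · exact hUX h
      · exact hUZ h

end Shading

end LinkDiagram

end ClassicalLink

/-! ### A discrete Stokes formula, and the Goeritz equations for Dehn colorings. -/

namespace ClassicalLink

section LevelPairing

variable {A : Type*} [AddCommGroup A]

/-- The value on the left of `g`, or zero if there is none. -/
def prevValue (x : ℕ → A) : ℕ → A
  | 0 => 0
  | g + 1 => x g

theorem prevValue_succ (x : ℕ → A) (g : ℕ) : prevValue x (g + 1) = x g := rfl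

theorem prevValue_congr {x y : ℕ → A} {g : ℕ} (h : ∀ j ≤ g, y j = x j) :
    prevValue y g = prevValue x g := by
  cases g with
  | zero => rfl
  | succ g => exact h g (Nat.le_succ g)

/-- The sum of the products of the values of `p` with the differences of the neighboring values
of `x`, at a level with `n` strands. -/
def levelPairing (n : ℕ) (p : ℕ → ℤ) (x : ℕ → A) : A :=
  ∑ g ∈ Finset.range (n + 1), p g • (x (g + 1) - prevValue x g)

theorem sum_range_three_parts (i s m : ℕ) (f : ℕ → A) :
    ∑ g ∈ Finset.range (i + s + m + 1), f g = ∑ g ∈ Finset.range i, f g +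
      ∑ j ∈ Finset.range (s + 1), f (i + j) + ∑ j ∈ Finset.range m, f (i + s + 1 + j) := by
  rw [show i + s + m + 1 = i + (s + 1) + m by omega, Finset.sum_range_add, Finset.sum_range_add]
  rfl

/-- At a minimum or maximum, the term of the inner gap vanishes because its neighbors have equal
colors, and the terms of these neighbors telescope. Only a crossing changes the pairing. -/
theorem levelPairing_out {e : Event} {n : ℕ} (he : e.Fits n) {p q : ℕ → ℤ} {x y : ℕ → A}
    (hpq : ∀ g h, e.Joins g h → q h = p g) (hxy : ∀ g h, e.Joins g h → y h = x g) :
    levelPairing (e.out n) q y = levelPairing n p x + match e.kind with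
      | .cup => 0
      | .cap => 0
      | .cross _ => (q (e.pos + 1) - p (e.pos + 1)) • (x (e.pos + 2) - x e.pos) +
          (p e.pos - p (e.pos + 2)) • (y (e.pos + 1) - x (e.pos + 1)) := by
  obtain ⟨a, i⟩ := e
  obtain ⟨m, rfl⟩ : ∃ m, n = i + a.src + m := Nat.exists_eq_add_of_le he
  have hout : Event.out ⟨a, i⟩ (i + a.src + m) = i + a.tgt + m := by
    simp only [Event.out]
    omega
  rw [hout]
  have ql : ∀ g ≤ i, q g = p g := fun g hg => hpq g g (Or.inl ⟨hg, rfl⟩)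
  have yl : ∀ g ≤ i, y g = x g := fun g hg => hxy g g (Or.inl ⟨hg, rfl⟩)
  have qr : ∀ j, q (i + a.tgt + j) = p (i + a.src + j) := fun j =>
    hpq _ _ (Or.inr ⟨by simp only; omega, by simp only; omega⟩)
  have yr : ∀ j, y (i + a.tgt + j) = x (i + a.src + j) := fun j =>
    hxy _ _ (Or.inr ⟨by simp only; omega, by simp only; omega⟩)
  unfold levelPairing
  rw [sum_range_three_parts, sum_range_three_parts]
  have h1 : ∑ g ∈ Finset.range i, q g • (y (g + 1) - prevValue y g) =
      ∑ g ∈ Finset.range i, p g • (x (g + 1) - prevValue x g) := by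
    refine Finset.sum_congr rfl fun g hg => ?_
    rw [Finset.mem_range] at hg
    rw [ql g hg.le, yl (g + 1) hg, prevValue_congr fun j hj => yl j (by omega)]
  have h3 : ∀ j, q (i + a.tgt + 1 + j) •
      (y (i + a.tgt + 1 + j + 1) - prevValue y (i + a.tgt + 1 + j)) =
      p (i + a.src + 1 + j) • (x (i + a.src + 1 + j + 1) - prevValue x (i + a.src + 1 + j)) := by
    intro j
    rw [show i + a.tgt + 1 + j = i + a.tgt + j + 1 by omega,
      show i + a.src + 1 + j = i + a.src + j + 1 by omega, prevValue_succ, prevValue_succ,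
      add_assoc _ j 1, add_assoc _ j 1, add_assoc _ (j + 1) 1, add_assoc _ (j + 1) 1, qr, yr, yr]
  rw [h1, Finset.sum_congr rfl fun j _ => h3 j]
  have q0 := ql i le_rfl
  have y0 := yl i le_rfl
  have yp : prevValue y i = prevValue x i := prevValue_congr yl
  have qr0 := qr 0
  have yr0 := yr 0
  have yr1 := yr 1
  rcases a with _ | _ | b
  · simp only [EventKind.tgt, EventKind.src, add_zero, add_assoc, Nat.reduceAdd] at qr0 yr0 yr1
    simp only [EventKind.tgt, EventKind.src, Finset.sum_range_succ, Finset.range_zero,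
      Finset.sum_empty, Nat.reduceAdd, add_zero, zero_add, add_assoc,
      prevValue_succ, yp, q0, y0, qr0,
      yr0, yr1]
    module
  · simp only [EventKind.tgt, EventKind.src, add_zero, add_assoc, Nat.reduceAdd] at qr0 yr0 yr1
    simp only [EventKind.tgt, EventKind.src, Finset.sum_range_succ, Finset.range_zero,
      Finset.sum_empty, Nat.reduceAdd, add_zero, zero_add, add_assoc,
      prevValue_succ, yp, q0, y0,
      ← qr0, ← yr0, yr1]
    module
  · simp only [EventKind.tgt, EventKind.src, add_zero, add_assoc, Nat.reduceAdd] at qr0 yr0 yr1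
    simp only [EventKind.tgt, EventKind.src, Finset.sum_range_succ, Finset.range_zero,
      Finset.sum_empty, Nat.reduceAdd, add_zero, zero_add, add_assoc,
      prevValue_succ, yp, q0, y0,
      qr0, yr0, yr1]
    module

end LevelPairing

namespace LinkDiagram

variable {D : LinkDiagram} {A : Type*} [AddCommGroup A] (σ : D.Shading)

/-- The contribution of a crossing to the pairing of two colorings. -/
def crossingPairing (h : D.Region → ℤ) (d : D.Region → A) (c : D.Crossing) : A :=
  (h c.top - h c.bottom) • (d c.right - d c.left) +
    (h c.left - h c.right) • (d c.top - d c.bottom)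

theorem levelPairing_eq_sum (h : D.Region → ℤ) (d : D.Region → A) {k : ℕ}
    (hk : k ≤ D.word.length) :
    levelPairing (D.width k) (levels h k) (levels d k) =
      ∑ c : D.Crossing with c.level < k, crossingPairing h d c := by
  classical
  induction k with
  | zero =>
    rw [Finset.filter_false_of_mem (by simp), Finset.sum_empty, levelPairing, D.width_zero]
    simp [prevValue, levels_of_width_lt d (k := 0) (g := 1) (by rw [D.width_zero]; omega)]
  | succ k ih =>
    have he := List.getElem?_eq_getElem (show k < D.word.length from hk)
    rw [D.width_succ he, levelPairing_out (fits he)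
      (fun g h' hj => levels_of_joins h he hj) (fun g h' hj => levels_of_joins d he hj),
      ih (Nat.le_of_succ_le hk)]
    have hsplit : (Finset.univ.filter fun c : D.Crossing => c.level < k + 1) =
        (Finset.univ.filter fun c : D.Crossing => c.level < k) ∪
          Finset.univ.filter fun c : D.Crossing => c.level = k := by
      ext c
      simp only [Finset.mem_filter, Finset.mem_univ, true_and, Finset.mem_union]
      omega
    rw [hsplit, Finset.sum_union (Finset.disjoint_filter.2 fun c _ h1 h2 => by omega)]
    congr 1
    generalize D.word[k] = e at he
    obtain ⟨a, i⟩ := e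
    have hnone : (a = .cup ∨ a = .cap) → (Finset.univ.filter fun c : D.Crossing => c.level = k) =
        ∅ := by
      intro ha
      refine Finset.filter_false_of_mem fun c _ hc => ?_
      have := c.spec
      rw [hc, he] at this
      rcases ha with rfl | rfl <;> simp [cross] at this
    rcases a with _ | _ | b
    · rw [hnone (Or.inl rfl), Finset.sum_empty]
    · rw [hnone (Or.inr rfl), Finset.sum_empty]
    · simp only
      let c : D.Crossing := ⟨k, i, b, he⟩
      have hone : (Finset.univ.filter fun c : D.Crossing => c.level = k) = {c} := by
        ext c'
        simp only [Finset.mem_filter, Finset.mem_univ, true_and, Finset.mem_singleton]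
        exact ⟨fun hc => Crossing.eq_of_level_eq hc, fun hc => by rw [hc]⟩
      rw [hone, Finset.sum_singleton, crossingPairing, ← c.levels_top h, ← c.levels_top d,
        ← c.levels_bottom h, ← c.levels_bottom d, ← c.levels_left h, ← c.levels_left d,
        ← c.levels_right h, ← c.levels_right d]

/-- The pairing starts and ends at levels without strands, where it is zero, so its total change
over all crossings is zero. -/
theorem sum_crossingPairing_eq_zero (h : D.Region → ℤ) (d : D.Region → A) :
    ∑ c : D.Crossing, crossingPairing h d c = 0 := by
  have h1 := levelPairing_eq_sum h d (le_refl D.word.length)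
  rw [Finset.filter_true_of_mem fun c _ => c.level_lt] at h1
  rw [← h1, levelPairing, D.width_length]
  simp [prevValue, levels_of_width_lt d (k := D.word.length) (g := 1) (by rw [D.width_length]; omega)]

/-- A Dehn coloring restricts to a solution of the Goeritz equations. -/
theorem Shading.curl_eq_zero_of_mem_dehnColorings {d : D.Region → A} (hd : d ∈ D.dehnColorings A)
    (R : D.Region) : σ.curl d R = 0 := by
  classical
  by_cases hR : σ.shaded R = true
  · exact σ.curl_eq_zero_of_shaded d hR
  -- For the indicator of an unshaded region, the Dehn condition turns each summand of the Stokes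
  -- formula into the corresponding summand of `curl`.
  rw [← sum_crossingPairing_eq_zero (Pi.single R 1) d]
  refine Finset.sum_congr rfl fun c _ => ?_
  have hc := mem_dehnColorings_iff.1 hd c
  have hl := c.shaded_left σ
  have hr := c.shaded_right σ
  have ht := c.shaded_top σ
  unfold crossingPairing goeritzIndex unshadedFst unshadedSnd
  have hne : ∀ R', σ.shaded R' = true → (Pi.single R 1 : D.Region → ℤ) R' = 0 := by
    intro R' hR'
    rw [Pi.single_apply, if_neg]
    rintro rfl
    exact hR hR'
  by_cases hb : σ.shaded c.bottom = true
  · rw [hne _ hb, hne _ (ht.trans hb), if_pos hb, if_pos hb, hb, hc]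
    simp only [Pi.single_apply]
    cases c.risingOver <;> simp only [crossValue, if_true, Bool.true_eq_false,
      Bool.false_eq_true, if_false] <;> split_ifs <;> module
  · rw [Bool.not_eq_true] at hb
    rw [hb] at hl hr
    rw [hne _ hl, hne _ hr, hb]
    simp only [Pi.single_apply, Bool.false_eq_true, if_false]
    rw [hc]
    cases c.risingOver <;> simp only [crossValue, if_true, Bool.false_eq_true, if_false] <;>
      split_ifs <;> module

end LinkDiagram

end ClassicalLink

/-! ### Extending solutions of the Goeritz equations to Dehn colorings. -/

namespace ClassicalLink

namespace LinkDiagram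

/-- The level of a gap, and its number within the level. -/
def Gap.level {D : LinkDiagram} (p : D.Gap) : ℕ := p.1.1

def Gap.index {D : LinkDiagram} (p : D.Gap) : ℕ := p.1.2

theorem Gap.ext' {D : LinkDiagram} {p q : D.Gap} (h1 : p.level = q.level)
    (h2 : p.index = q.index) : p = q :=
  Subtype.ext (Prod.ext h1 h2)

theorem GapJoined.exists_event {D : LinkDiagram} {p q : D.Gap} (h : D.GapJoined p q) :
    ∃ e : Event, D.word[p.level]? = some e ∧ q.level = p.level + 1 ∧ e.Joins p.index q.index := h

namespace Crossing

variable {D : LinkDiagram} (c : D.Crossing)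

@[simp] theorem level_gapLeft : c.gapLeft.level = c.level := rfl
@[simp] theorem level_gapRight : c.gapRight.level = c.level := rfl
@[simp] theorem level_gapBottom : c.gapBottom.level = c.level := rfl
@[simp] theorem level_gapTop : c.gapTop.level = c.level + 1 := rfl
@[simp] theorem level_gapLeftAbove : c.gapLeftAbove.level = c.level + 1 := rfl
@[simp] theorem index_gapLeft : c.gapLeft.index = c.pos := rfl
@[simp] theorem index_gapRight : c.gapRight.index = c.pos + 2 := rfl
@[simp] theorem index_gapBottom : c.gapBottom.index = c.pos + 1 := rfl
@[simp] theorem index_gapTop : c.gapTop.index = c.pos + 1 := rfl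
@[simp] theorem index_gapLeftAbove : c.gapLeftAbove.index = c.pos := rfl

end Crossing

namespace Shading

variable {D : LinkDiagram} {A : Type*} [AddCommGroup A] (σ : D.Shading)

/-- The terms that a crossing contributes to the divergence at the gaps next to it; they vanish
unless the corners in question are unshaded. -/
def sideTerm (d : D.Region → A) (c : D.Crossing) : A :=
  if σ.shaded c.bottom then σ.goeritzIndex c • (d c.left - d c.right) else 0

def verticalTerm (d : D.Region → A) (c : D.Crossing) : A :=
  if σ.shaded c.bottom then 0 else σ.goeritzIndex c • (d c.bottom - d c.top)

open scoped Classical in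
theorem curl_eq_sum (d : D.Region → A) (R : D.Region) : σ.curl d R =
    ∑ c, ((if c.left = R then σ.sideTerm d c else 0) +
      (if c.right = R then -σ.sideTerm d c else 0) +
      (if c.bottom = R then σ.verticalTerm d c else 0) +
      if c.top = R then -σ.verticalTerm d c else 0) := by
  refine Finset.sum_congr rfl fun c _ => ?_
  unfold unshadedFst unshadedSnd sideTerm verticalTerm
  split_ifs <;> module

/-- The gap `p` lies on the same level as `q`, to the left of it. -/
def _root_.ClassicalLink.LinkDiagram.GapBefore (p q : D.Gap) : Prop :=
  p.level = q.level ∧ p.index < q.index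

/-- The region that contains a gap. -/
def _root_.ClassicalLink.LinkDiagram.gapRegion (p : D.Gap) : D.Region := Quot.mk _ p

open scoped Classical in
/-- The gap sums of a flow through the unshaded gaps change from level to level only at
crossings. -/
theorem exists_gap_potential (d : D.Region → A) (hd : ∀ R, σ.curl d R = 0) :
    ∃ s : D.Gap → A, ∀ P Q : D.Gap,
      (∀ p q : D.Gap, D.GapJoined p q → σ.shaded (gapRegion p) = false →
        (GapBefore p P ↔ GapBefore q Q)) →
      s Q - s P = ∑ c : D.Crossing, ((if GapBefore c.gapLeft P then σ.sideTerm d c else 0) +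
        (if GapBefore c.gapRight P then -σ.sideTerm d c else 0) +
        (if GapBefore c.gapBottom P then σ.verticalTerm d c else 0) +
        if GapBefore c.gapTop Q then -σ.verticalTerm d c else 0) := by
  let src : D.Gap → A := fun p => ∑ c : D.Crossing, if c.gapTop = p then -σ.verticalTerm d c else 0
  let snk : D.Gap → A := fun p => ∑ c : D.Crossing, ((if c.gapLeft = p then σ.sideTerm d c else 0) +
    (if c.gapRight = p then -σ.sideTerm d c else 0) +
    if c.gapBottom = p then σ.verticalTerm d c else 0)
  -- The classes of gaps are the regions, and the Goeritz equation at a region says that the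
  -- prescribed divergences on it sum to zero. The flow runs between joined gaps of adjacent levels.
  obtain ⟨x, hx, hdiv⟩ := exists_flow_of_sum_eq_zero D.GapJoined (fun p => src p + snk p) (by
    intro R
    rw [← Finset.sum_filter]
    refine Eq.trans ?_ ((σ.curl_eq_sum d R).symm.trans (hd R))
    simp only [src, snk, ← Finset.sum_add_distrib]
    rw [Finset.sum_comm]
    refine Finset.sum_congr rfl fun c _ => ?_
    have key : ∀ (r : D.Gap) (a : A), ∑ p with Quot.mk D.GapJoined p = R, (if r = p then a else 0) =
        if gapRegion r = R then a else 0 := by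
      intro r a
      rw [Finset.sum_ite_eq]
      exact if_congr (Finset.mem_filter.trans (and_iff_right (Finset.mem_univ r))) rfl rfl
    simp only [Finset.sum_add_distrib, key]
    change _ = (if gapRegion c.gapLeft = R then σ.sideTerm d c else 0) +
      (if gapRegion c.gapRight = R then -σ.sideTerm d c else 0) +
      (if gapRegion c.gapBottom = R then σ.verticalTerm d c else 0) +
      if gapRegion c.gapTop = R then -σ.verticalTerm d c else 0
    abel)
  -- The amount that passes through the gap: what comes from the level below plus what the crossing
  -- below it releases, or equally, by `hδ`, what leaves upwards minus the term of the crossing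
  -- above.
  let δ : D.Gap → A := fun p => ∑ q, x q p + src p
  have hδ : ∀ p, δ p = ∑ q, x p q - snk p := by
    intro p
    have := hdiv p
    simp only [δ]
    rw [sub_eq_iff_eq_add] at this
    rw [this]
    abel
  let U : D.Gap → Prop := fun p => σ.shaded (gapRegion p) = false
  have hside : ∀ c : D.Crossing, ¬ U c.gapLeft → σ.sideTerm d c = 0 := by
    intro c hc
    refine if_neg fun h => hc ?_
    change σ.shaded c.left = false
    rw [c.shaded_left, h]
    rfl
  have hside' : ∀ c : D.Crossing, ¬ U c.gapRight → σ.sideTerm d c = 0 := by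
    intro c hc
    refine if_neg fun h => hc ?_
    change σ.shaded c.right = false
    rw [c.shaded_right, h]
    rfl
  have hvert : ∀ c : D.Crossing, ¬ U c.gapBottom → σ.verticalTerm d c = 0 := by
    intro c hc
    exact if_pos ((Bool.not_eq_false _).mp hc)
  have hvert' : ∀ c : D.Crossing, ¬ U c.gapTop → σ.verticalTerm d c = 0 := by
    intro c hc
    refine if_pos ?_
    rw [← c.shaded_top]
    exact (Bool.not_eq_false _).mp hc
  refine ⟨fun P => ∑ p with U p ∧ GapBefore p P, δ p, fun P Q hPQ => ?_⟩
  have hQ : ∑ p with U p ∧ GapBefore p Q, δ p =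
      ∑ p with U p ∧ GapBefore p Q, ∑ q, x q p +
        ∑ c : D.Crossing, if GapBefore c.gapTop Q then -σ.verticalTerm d c else 0 := by
    simp only [δ, src, Finset.sum_add_distrib]
    congr 1
    rw [Finset.sum_comm]
    refine Finset.sum_congr rfl fun c _ => ?_
    rw [Finset.sum_ite_eq]
    by_cases h : U c.gapTop
    · simp [h]
    · simp [hvert' c h]
  have hP : ∑ p with U p ∧ GapBefore p P, δ p =
      ∑ p with U p ∧ GapBefore p P, ∑ q, x p q -
        ∑ c : D.Crossing, ((if GapBefore c.gapLeft P then σ.sideTerm d c else 0) +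
        (if GapBefore c.gapRight P then -σ.sideTerm d c else 0) +
        (if GapBefore c.gapBottom P then σ.verticalTerm d c else 0)) := by
    simp only [hδ, snk, Finset.sum_sub_distrib]
    congr 1
    rw [Finset.sum_comm]
    refine Finset.sum_congr rfl fun c _ => ?_
    simp only [Finset.sum_add_distrib, Finset.sum_ite_eq, Finset.mem_filter, Finset.mem_univ,
      true_and]
    congr 1
    · congr 1
      · by_cases h : U c.gapLeft
        · simp [h]
        · simp [hside c h]
      · by_cases h : U c.gapRight
        · simp [h]
        · simp [hside' c h]
    · by_cases h : U c.gapBottom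
      · simp [h]
      · simp [hvert c h]
  -- By `hPQ`, an edge carrying flow in an unshaded region begins to the left of `P` exactly when it
  -- ends to the left of `Q`, so both sums count the same edges.
  have hflow : ∑ p with U p ∧ GapBefore p Q, ∑ q, x q p =
      ∑ p with U p ∧ GapBefore p P, ∑ q, x p q := by
    rw [Finset.sum_comm]
    conv_lhs => enter [2, q]; rw [Finset.sum_filter]
    rw [Finset.sum_filter]
    refine Finset.sum_congr rfl fun p _ => ?_
    by_cases hp : U p ∧ GapBefore p P
    · rw [if_pos hp]
      refine Finset.sum_congr rfl fun q _ => ?_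
      by_cases hj : D.GapJoined p q
      · rw [if_pos]
        refine ⟨?_, (hPQ p q hj hp.1).1 hp.2⟩
        have : gapRegion p = gapRegion q := Quot.sound hj
        simpa only [U, ← this] using hp.1
      · rw [hx p q hj, ite_self]
    · rw [if_neg hp]
      refine Finset.sum_eq_zero fun q _ => ?_
      by_cases hj : D.GapJoined p q
      · refine if_neg fun hq => hp ?_
        have : gapRegion p = gapRegion q := Quot.sound hj
        have hU : U p := by simpa only [U, this] using hq.1
        exact ⟨hU, (hPQ p q hj hU).2 hq.2⟩
      · rw [hx p q hj, ite_self]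
  simp only
  rw [hQ, hP, hflow]
  simp only [Finset.sum_add_distrib]
  abel

theorem joins_of_gapJoined {c : D.Crossing} {p q : D.Gap} (h : D.GapJoined p q)
    (hp : p.level = c.level) :
    q.level = c.level + 1 ∧ q.index = p.index ∧ (p.index ≤ c.pos ∨ c.pos + 2 ≤ p.index) := by
  obtain ⟨e, he, hq, hj⟩ := h.exists_event
  rw [hp, c.spec, Option.some.injEq] at he
  subst he
  simp only [Event.Joins, cross, EventKind.src, EventKind.tgt] at hj
  omega

/-- Every solution of the Goeritz equations extends to a Dehn coloring. -/
theorem exists_dehnColoring_of_curl_eq_zero (d : D.Region → A)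
    (hd : ∀ R, σ.shaded R = false → σ.curl d R = 0) :
    ∃ d' ∈ D.dehnColorings A, ∀ R, σ.shaded R = false → d' R = d R := by
  classical
  obtain ⟨s, hs⟩ := σ.exists_gap_potential d fun R => by
    by_cases hR : σ.shaded R = true
    · exact σ.curl_eq_zero_of_shaded d hR
    · exact hd R (by simpa using hR)
  -- The potential is constant on shaded regions. The terms of a crossing that lies entirely to the
  -- left cancel in pairs; if `P` is the right corner of the crossing, the side term is zero since
  -- this corner is shaded.
  have hjoin : ∀ P Q : D.Gap, D.GapJoined P Q → σ.shaded (gapRegion P) = true → s Q = s P := by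
    intro P Q hPQ hP
    rw [← sub_eq_zero, hs P Q]
    · refine Finset.sum_eq_zero fun c _ => ?_
      by_cases hc : P.level = c.level
      · obtain ⟨h1, h2, h3⟩ := joins_of_gapJoined hPQ hc
        simp only [GapBefore, Crossing.level_gapLeft, Crossing.level_gapRight,
          Crossing.level_gapBottom, Crossing.level_gapTop, Crossing.index_gapLeft,
          Crossing.index_gapRight, Crossing.index_gapBottom, Crossing.index_gapTop, h1, h2, hc,
          true_and]
        rcases h3 with h3 | h3
        · rw [if_neg (by omega), if_neg (by omega), if_neg (by omega), if_neg (by omega)]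
          simp
        · rw [if_pos (show c.pos < P.index by omega), if_pos (show c.pos + 1 < P.index by omega),
            if_pos (show c.pos + 1 < P.index by omega)]
          by_cases h4 : c.pos + 2 < P.index
          · rw [if_pos h4]
            abel
          · have h5 : P = c.gapRight := Gap.ext' hc (by
              change P.index = c.pos + 2
              omega)
            have h6 : σ.shaded c.right = true := by rw [← hP, h5]; rfl
            rw [c.shaded_right] at h6
            have h7 : σ.sideTerm d c = 0 := if_neg (by simpa using h6)
            rw [if_neg h4, h7]
            abel
      · have h1 : Q.level = P.level + 1 := by
          obtain ⟨e, -, h, -⟩ := hPQ.exists_event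
          exact h
        simp [GapBefore, h1, Ne.symm hc]
    · intro p q hpq hp
      obtain ⟨e, he, hQ, hj⟩ := hPQ.exists_event
      obtain ⟨f, hf, hq, hj'⟩ := hpq.exists_event
      unfold GapBefore
      by_cases hl : p.level = P.level
      · rw [hl, he, Option.some.injEq] at hf
        subst hf
        -- Joining preserves the order of gaps within a slice except that gaps may merge; an
        -- unshaded gap never merges with a shaded one.
        have hne : q.index ≠ Q.index := by
          intro h
          have h1 : q = Q := Gap.ext' (by omega) h
          have h2 : gapRegion p = gapRegion q := Quot.sound hpq
          have h3 : gapRegion P = gapRegion Q := Quot.sound hPQ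
          rw [h2, h1, ← h3, hP] at hp
          exact absurd hp (by simp)
        have hne' : p.index ≠ P.index := by
          intro h
          rw [Gap.ext' hl h, hP] at hp
          exact absurd hp (by simp)
        unfold Event.Joins at hj hj'
        omega
      · omega
  have hcross : ∀ c : D.Crossing, (σ.shaded c.bottom = false →
      s c.gapLeft - s c.gapRight = σ.goeritzIndex c • (d c.bottom - d c.top)) ∧
      (σ.shaded c.bottom = true →
      s c.gapTop - s c.gapBottom = σ.goeritzIndex c • (d c.left - d c.right)) := by
    intro c
    have hother : ∀ c' : D.Crossing, c' ≠ c → c'.level ≠ c.level :=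
      fun c' hc' h => hc' (Crossing.eq_of_level_eq h)
    refine ⟨fun hb => ?_, fun hb => ?_⟩
    · have hl : σ.shaded (gapRegion c.gapLeft) = true := by
        change σ.shaded c.left = true
        rw [c.shaded_left, hb]
        rfl
      -- The left corner is viewed one level higher, so that the comparison with the right corner
      -- passes between the unshaded bottom and top corners; only the vertical term of `c` remains.
      rw [← hjoin _ _ c.gapJoined_left hl, hs]
      · rw [Finset.sum_eq_single c]
        · simp [GapBefore, sideTerm, verticalTerm, hb]
        · intro c' _ hc'
          have := hother c' hc'
          simp [GapBefore, this]
        · simp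
      · intro p q hpq hp
        by_cases h : p.level = c.level
        · obtain ⟨h1, h2, h3⟩ := joins_of_gapJoined hpq h
          have h4 : p.index ≠ c.pos := by
            intro h4
            rw [Gap.ext' (q := c.gapLeft) h h4, hl] at hp
            exact absurd hp (by simp)
          simp only [GapBefore, Crossing.level_gapRight, Crossing.index_gapRight,
            Crossing.level_gapLeftAbove, Crossing.index_gapLeftAbove, h, h1, h2, true_and]
          omega
        · obtain ⟨e, -, h1, -⟩ := hpq.exists_event
          simp only [GapBefore, Crossing.level_gapRight, Crossing.level_gapLeftAbove]
          omega
    · rw [hs]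
      · rw [Finset.sum_eq_single c]
        · simp [GapBefore, sideTerm, hb]
        · intro c' _ hc'
          have := hother c' hc'
          simp [GapBefore, this]
        · simp
      · intro p q hpq hp
        by_cases h : p.level = c.level
        · obtain ⟨h1, h2, h3⟩ := joins_of_gapJoined hpq h
          simp only [GapBefore, Crossing.level_gapBottom, Crossing.index_gapBottom,
            Crossing.level_gapTop, Crossing.index_gapTop, h, h1, h2, true_and]
        · obtain ⟨e, -, h1, -⟩ := hpq.exists_event
          simp only [GapBefore, Crossing.level_gapBottom, Crossing.level_gapTop]
          omega
  -- Shaded regions receive the potential, and unshaded ones keep their colors.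
  let d' : D.Region → A := Quot.lift
    (fun p => if σ.shaded (gapRegion p) = true then s p else d (gapRegion p)) (by
      intro p q hpq
      have h : gapRegion p = gapRegion q := Quot.sound hpq
      rw [← h]
      split_ifs with hp
      · exact (hjoin p q hpq hp).symm
      · rfl)
  have hd' : ∀ p : D.Gap, d' (gapRegion p) =
      if σ.shaded (gapRegion p) = true then s p else d (gapRegion p) := fun p => rfl
  refine ⟨d', mem_dehnColorings_iff.2 fun c => ?_, fun R hR => ?_⟩
  · have hl := c.shaded_left σ
    have hr := c.shaded_right σ
    have ht := c.shaded_top σ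
    change d' (gapRegion c.gapTop) = crossValue c.risingOver (d' (gapRegion c.gapLeft))
      (d' (gapRegion c.gapBottom)) (d' (gapRegion c.gapRight))
    simp only [hd']
    change (if σ.shaded c.top = true then _ else d c.top) = crossValue c.risingOver
      (if σ.shaded c.left = true then _ else d c.left)
      (if σ.shaded c.bottom = true then _ else d c.bottom)
      (if σ.shaded c.right = true then _ else d c.right)
    rw [hl, hr, ht]
    by_cases hb : σ.shaded c.bottom = true
    · have h := (hcross c).2 hb
      rw [sub_eq_iff_eq_add] at h
      simp only [hb, Bool.not_true, Bool.false_eq_true, if_true, if_false, h, goeritzIndex]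
      cases c.risingOver <;>
        simp only [crossValue, if_true, Bool.false_eq_true, Bool.true_eq_false, if_false] <;> module
    · rw [Bool.not_eq_true] at hb
      have h := (hcross c).1 hb
      rw [sub_eq_iff_eq_add] at h
      simp only [hb, Bool.not_false, Bool.false_eq_true, if_true, if_false, h, goeritzIndex]
      cases c.risingOver <;>
        simp only [crossValue, if_true, Bool.false_eq_true, if_false] <;> module
  · induction R using Quot.ind with
    | mk p => exact if_neg (by rw [Bool.not_eq_true]; exact hR)

end Shading

end LinkDiagram

end ClassicalLink

/-! ### Splitting off the components of the shaded graph, and the final comparison. -/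

theorem nonempty_torsionPi_addEquiv_of_eq {r s : ℕ} (h : r = s) (k : Fin r → ℕ) (l : Fin s → ℕ)
    (hkl : ∀ i, k i = l (Fin.cast h i)) (A : Type*) [AddCommGroup A] :
    Nonempty (torsionPi k A ≃+ torsionPi l A) := by
  subst h
  obtain rfl : k = l := funext hkl
  exact ⟨AddEquiv.refl _⟩

theorem Matrix.nonempty_kerIn_fromBlocks_addEquiv {m n A : Type*} [Fintype m] [Fintype n]
    [AddCommGroup A] (M : Matrix m m ℤ) :
    Nonempty ((Matrix.fromBlocks M 0 0 (0 : Matrix n n ℤ)).kerIn A ≃+ M.kerIn A × (n → A)) :=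
  ⟨{ toFun := fun v => (⟨fun i => v.1 (Sum.inl i), fun i => by
      have : ∑ j, Matrix.fromBlocks M 0 0 (0 : Matrix n n ℤ) (Sum.inl i) j • v.1 j = 0 :=
        v.2 (Sum.inl i)
      simpa using this⟩, fun j => v.1 (Sum.inr j))
     invFun := fun w => ⟨Sum.elim w.1.1 w.2, fun i => by
      rcases i with i | i
      · have : ∑ j, M i j • w.1.1 j = 0 := w.1.2 i
        simpa using this
      · simp⟩
     left_inv := fun v => by
      ext (i | i) <;> rfl
     right_inv := fun w => rfl
     map_add' := fun v w => rfl }⟩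

namespace ClassicalLink

namespace LinkDiagram

namespace Shading

variable {D : LinkDiagram} (σ : D.Shading)

/-- As the diagram is not empty, its first event is a minimum, and the two sides of one of its legs
have different shades. -/
theorem exists_shaded_unshaded : (∃ R, σ.shaded R = true) ∧ ∃ R, σ.shaded R = false := by
  obtain ⟨e, w, hw⟩ := List.exists_cons_of_ne_nil D.nonempty
  have he : D.word[0]? = some e := by rw [hw]; rfl
  have hlen : 1 ≤ D.word.length := by rw [hw]; simp
  have hwidth : 0 + 1 ≤ D.width 1 := by
    have hf := fits he
    rw [D.width_succ he]
    rw [D.width_zero] at hf ⊢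
    obtain ⟨_ | _ | b, i⟩ := e <;>
      simp_all [Event.Fits, Event.out, EventKind.src, EventKind.tgt]
  have h := σ.alternate 1 0 hlen hwidth
  by_cases h0 : σ.shaded (D.region 1 0 hlen (Nat.le_of_succ_le hwidth)) = true
  · rw [h0] at h
    exact ⟨⟨_, h0⟩, ⟨_, by simpa using h.symm⟩⟩
  · rw [Bool.not_eq_true] at h0
    rw [h0] at h
    exact ⟨⟨_, by simpa using h.symm⟩, ⟨_, h0⟩⟩

instance : Finite σ.Shaded := inferInstanceAs (Finite {R : D.Region // σ.shaded R = true})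

instance : Finite σ.shadedGraph.ConnectedComponent :=
  inferInstanceAs (Finite (Quot σ.shadedGraph.Reachable))

theorem beta_pos : 0 < σ.beta := by
  obtain ⟨⟨R, hR⟩, -⟩ := σ.exists_shaded_unshaded
  have : Nonempty σ.shadedGraph.ConnectedComponent :=
    ⟨σ.shadedGraph.connectedComponentMk ⟨R, hR⟩⟩
  exact Nat.card_pos

theorem order_pos : 0 < σ.order := by
  obtain ⟨-, ⟨R, hR⟩⟩ := σ.exists_shaded_unshaded
  exact Fintype.card_pos_iff.2 ⟨Sum.inl ⟨R, hR⟩⟩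

theorem sum_goeritz (U : σ.Unshaded) : ∑ V, σ.goeritz U V = 0 := by
  have h := σ.sum_goeritz_smul (fun _ => (1 : ℤ)) U
  simpa [curl] using h

/-- The vector that is `1` on the unshaded regions and `0` on the added coordinates lies in the
kernel, and it is nonzero because there is an unshaded region. -/
theorem invariantFactor_zero : σ.adjustedGoeritz.invariantFactor 0 = 0 := by
  classical
  obtain ⟨-, ⟨R, hR⟩⟩ := σ.exists_shaded_unshaded
  refine Matrix.invariantFactor_zero_eq_zero _ (Sum.elim 1 0) (fun h => ?_) ?_
  · have : (1 : ℤ) = 0 := congrFun h (Sum.inl ⟨R, hR⟩)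
    exact one_ne_zero this
  · rw [adjustedGoeritz, Matrix.fromBlocks_mulVec]
    ext (U | j)
    · simp [Matrix.mulVec, dotProduct, sum_goeritz]
    · simp

variable {A : Type*} [AddCommGroup A]

theorem mem_dehnColorings_of_balanced {d : D.Region → A}
    (h : ∀ c : D.Crossing, d c.left = d c.right ∧ d c.top = d c.bottom) :
    d ∈ D.dehnColorings A := by
  rw [mem_dehnColorings_iff]
  intro c
  rw [(h c).1, (h c).2, crossValue]
  split_ifs <;> abel

/-- When the unshaded colors vanish, the Dehn condition equates the two shaded corners. Together
with `eq_of_connectedComponentMk_eq`, this describes the kernel of the restriction to the unshaded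
regions. -/
theorem balanced_of_mem_dehnColorings {d : D.Region → A} (hd : d ∈ D.dehnColorings A)
    (h0 : ∀ R, σ.shaded R = false → d R = 0) (c : D.Crossing) :
    d c.left = d c.right ∧ d c.top = d c.bottom := by
  have hl := c.shaded_left σ
  have hr := c.shaded_right σ
  have ht := c.shaded_top σ
  have h := mem_dehnColorings_iff.1 hd c
  by_cases hb : σ.shaded c.bottom = true
  · rw [hb] at hl hr
    rw [h0 _ hl, h0 _ hr] at h ⊢
    refine ⟨rfl, h.trans ?_⟩
    unfold crossValue
    split_ifs <;> abel
  · rw [Bool.not_eq_true] at hb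
    rw [hb] at ht
    rw [h0 _ ht, h0 _ hb] at h ⊢
    refine ⟨?_, rfl⟩
    unfold crossValue at h
    split_ifs at h
    · simpa [sub_eq_zero] using h.symm
    · simpa [sub_eq_zero] using (sub_eq_zero.1 (by simpa using h.symm)).symm

theorem eq_of_connectedComponentMk_eq {B : Type*} {d : D.Region → B}
    (h : ∀ c : D.Crossing, d c.left = d c.right ∧ d c.top = d c.bottom) {R S : σ.Shaded}
    (hRS : σ.shadedGraph.connectedComponentMk R = σ.shadedGraph.connectedComponentMk S) :
    d R.1 = d S.1 := by
  have hinc : ∀ (c : D.Crossing) (R S : σ.Shaded), c.Incident R.1 → c.Incident S.1 →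
      d R.1 = d S.1 := by
    rintro c ⟨R, hR⟩ ⟨S, hS⟩ hcR hcS
    have hl := c.shaded_left σ
    have hr := c.shaded_right σ
    have ht := c.shaded_top σ
    have h1 := (h c).1
    have h2 := (h c).2
    simp only at hcR hcS ⊢
    rcases hcR with rfl | rfl | rfl | rfl <;> rcases hcS with rfl | rfl | rfl | rfl <;>
      first
      | rfl
      | assumption
      | (symm; assumption)
      | simp_all
  obtain ⟨p⟩ := SimpleGraph.ConnectedComponent.exact hRS
  induction p with
  | nil => rfl
  | cons hadj _ ih =>
    rw [← ih (SimpleGraph.ConnectedComponent.sound ⟨‹_›⟩)]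
    obtain ⟨-, ⟨c, hc1, hc2⟩ | ⟨c, hc1, hc2⟩⟩ := hadj
    · exact hinc c _ _ hc1 hc2
    · exact hinc c _ _ hc2 hc1

/-- A coloring of the components of the shaded graph, extended by zero to the unshaded regions. -/
noncomputable def componentColoring (a : σ.shadedGraph.ConnectedComponent → A) (R : D.Region) : A :=
  if h : σ.shaded R = true then a (σ.shadedGraph.connectedComponentMk ⟨R, h⟩) else 0

theorem componentColoring_of_shaded (a : σ.shadedGraph.ConnectedComponent → A) (R : σ.Shaded) :
    σ.componentColoring a R.1 = a (σ.shadedGraph.connectedComponentMk R) :=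
  dif_pos R.2

theorem componentColoring_of_unshaded (a : σ.shadedGraph.ConnectedComponent → A) {R : D.Region}
    (hR : σ.shaded R = false) : σ.componentColoring a R = 0 :=
  dif_neg (by simp [hR])

theorem componentColoring_mem (a : σ.shadedGraph.ConnectedComponent → A) :
    σ.componentColoring a ∈ D.dehnColorings A := by
  have key : ∀ (c : D.Crossing) (R S : D.Region), c.Incident R → c.Incident S →
      σ.shaded R = σ.shaded S → σ.componentColoring a R = σ.componentColoring a S := by
    intro c R S hR hS hRS
    by_cases h : σ.shaded R = true
    · rw [σ.componentColoring_of_shaded a ⟨R, h⟩, σ.componentColoring_of_shaded a ⟨S, hRS ▸ h⟩]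
      by_cases hne : R = S
      · subst hne
        rfl
      · congr 1
        refine SimpleGraph.ConnectedComponent.sound (SimpleGraph.Adj.reachable ?_)
        exact ⟨fun h => hne (congrArg Subtype.val h), Or.inl ⟨c, hR, hS⟩⟩
    · rw [Bool.not_eq_true] at h
      rw [σ.componentColoring_of_unshaded a h, σ.componentColoring_of_unshaded a (hRS ▸ h)]
  refine mem_dehnColorings_of_balanced fun c => ⟨key c _ _ (Or.inl rfl) (Or.inr (Or.inl rfl)) ?_,
    key c _ _ (Or.inr (Or.inr (Or.inr rfl))) (Or.inr (Or.inr (Or.inl rfl))) (c.shaded_top σ)⟩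
  rw [c.shaded_left, c.shaded_right]

/-- The group of Dehn colorings splits into the colorings of the components of the shaded graph
and the kernel of the Goeritz matrix. -/
theorem nonempty_dehnColorings_addEquiv_prod (A : Type*) [AddCommGroup A] :
    Nonempty (D.dehnColorings A ≃+
      (σ.shadedGraph.ConnectedComponent → A) × σ.goeritz.kerIn A) := by
  let f : D.dehnColorings A →+ (σ.shadedGraph.ConnectedComponent → A) × σ.goeritz.kerIn A :=
    { toFun := fun d => (fun C => d.1 (Quot.out C).1, ⟨fun U => d.1 U.1, fun U => by
        rw [σ.sum_goeritz_smul]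
        exact σ.curl_eq_zero_of_mem_dehnColorings d.2 U.1⟩)
      map_zero' := rfl
      map_add' := fun _ _ => rfl }
  have hout : ∀ C : σ.shadedGraph.ConnectedComponent,
      σ.shadedGraph.connectedComponentMk (Quot.out C) = C := fun C => Quot.out_eq C
  refine ⟨AddEquiv.ofBijective f ⟨(injective_iff_map_eq_zero f).2 fun d hd => ?_, ?_⟩⟩
  · have h1 : ∀ C : σ.shadedGraph.ConnectedComponent, d.1 (Quot.out C).1 = 0 := fun C =>
      congrFun (congrArg Prod.fst hd) C
    have h2 : ∀ R, σ.shaded R = false → d.1 R = 0 := fun R hR =>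
      congrFun (congrArg Subtype.val (congrArg Prod.snd hd)) ⟨R, hR⟩
    ext R
    by_cases hR : σ.shaded R = true
    · have h3 := σ.eq_of_connectedComponentMk_eq (σ.balanced_of_mem_dehnColorings d.2 h2)
        (hout (σ.shadedGraph.connectedComponentMk ⟨R, hR⟩))
      rw [h1] at h3
      exact h3.symm
    · exact h2 R (by simpa using hR)
  · rintro ⟨a, ⟨u, hu⟩⟩
    let d : D.Region → A := fun R => if h : σ.shaded R = false then u ⟨R, h⟩ else 0
    have hdu : ∀ U : σ.Unshaded, d U.1 = u U := fun U => dif_pos U.2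
    obtain ⟨d', hd', hdd'⟩ := σ.exists_dehnColoring_of_curl_eq_zero d (by
      intro R hR
      rw [← σ.sum_goeritz_smul d ⟨R, hR⟩]
      simp only [hdu]
      exact hu ⟨R, hR⟩)
    -- The correction adjusts the color at the representative of each component to `a` and does not
    -- affect the unshaded regions.
    refine ⟨⟨d' + σ.componentColoring fun C => a C - d' (Quot.out C).1,
      AddSubgroup.add_mem _ hd' (σ.componentColoring_mem _)⟩, Prod.ext ?_ (Subtype.ext ?_)⟩
    · funext C
      change d' (Quot.out C).1 + σ.componentColoring _ (Quot.out C).1 = a C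
      rw [componentColoring_of_shaded, hout]
      abel
    · funext U
      change d' U.1 + σ.componentColoring _ U.1 = u U
      rw [σ.componentColoring_of_unshaded _ U.2, hdd' _ U.2, hdu, add_zero]

/-- Since `β_s ≥ 1`, one of the component colors can be split off as the factor `A`; the other `β_s
- 1` are the free coordinates of the zero block. -/
theorem nonempty_dehnColorings_addEquiv_adjustedGoeritz (A : Type*) [AddCommGroup A] :
    Nonempty (D.dehnColorings A ≃+ A × σ.adjustedGoeritz.kerIn A) := by
  obtain ⟨f⟩ := σ.nonempty_dehnColorings_addEquiv_prod A
  obtain ⟨g⟩ := Matrix.nonempty_kerIn_fromBlocks_addEquiv (n := Fin (σ.beta - 1)) (A := A)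
    σ.goeritz
  have e : σ.shadedGraph.ConnectedComponent ≃ Option (Fin (σ.beta - 1)) :=
    (Finite.equivFinOfCardEq (show Nat.card _ = σ.beta - 1 + 1 by
      have := σ.beta_pos
      unfold beta at this ⊢
      omega)).trans (finSuccEquiv _)
  let h : (σ.shadedGraph.ConnectedComponent → A) ≃+ A × (Fin (σ.beta - 1) → A) :=
    { toFun := fun a => (a (e.symm none), fun j => a (e.symm (some j)))
      invFun := fun b C => Option.elim (e C) b.1 b.2
      left_inv := fun a => by
        funext C
        obtain ⟨o, rfl⟩ := e.symm.surjective C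
        cases o <;> simp
      right_inv := fun b => by simp
      map_add' := fun _ _ => rfl }
  exact ⟨f.trans ((h.prodCongr (AddEquiv.refl _)).trans (AddEquiv.prodAssoc.trans
    ((AddEquiv.refl A).prodCongr (AddEquiv.prodComm.trans g.symm))))⟩

end Shading

end LinkDiagram

end ClassicalLink

theorem corollary3 (D : ClassicalLink.LinkDiagram) (σ : D.Shading) :
    0 < σ.order ∧ σ.adjustedGoeritz.invariantFactor 0 = 0 ∧
    ∃ T : ClassicalLink.Link,
      ClassicalLink.IsIteratedConnectedSum
        ((List.range (σ.order - 1)).map fun j =>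
          ClassicalLink.torusLink (σ.adjustedGoeritz.invariantFactor (j + 1))) T ∧
      ∀ (A : Type*) [AddCommGroup A] (D_T : ClassicalLink.LinkDiagram), D_T.IsDiagramOf T →
        Nonempty (D.dehnColorings A ≃+ D_T.dehnColorings A) := by
  have hpos := σ.order_pos
  refine ⟨hpos, σ.invariantFactor_zero, ?_⟩
  let ks : List ℕ :=
    (List.range (σ.order - 1)).map fun j => σ.adjustedGoeritz.invariantFactor (j + 1)
  refine ⟨_, by simpa [ks, Function.comp_def] using
    ClassicalLink.isIteratedConnectedSum_torusSum ks, ?_⟩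
  intro A _ D_T hT
  obtain ⟨f₁⟩ := σ.nonempty_dehnColorings_addEquiv_adjustedGoeritz A
  obtain ⟨f₂⟩ := σ.adjustedGoeritz.nonempty_kerIn_addEquiv_torsionPi (A := A)
    (r := σ.order - 1 + 1) (Nat.sub_add_cancel hpos).symm
  obtain ⟨f₃⟩ := nonempty_torsionPi_addEquiv_of_zero
    (fun j : Fin (σ.order - 1 + 1) => σ.adjustedGoeritz.invariantFactor j)
    σ.invariantFactor_zero A
  obtain ⟨f₄⟩ := nonempty_torsionPi_addEquiv_of_eq (show ks.length = σ.order - 1 by simp [ks])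
    ks.get (fun j => σ.adjustedGoeritz.invariantFactor (j.succ : Fin (σ.order - 1 + 1)))
    (fun i => by simp [ks]) A
  obtain ⟨g₁⟩ := ClassicalLink.LinkDiagram.nonempty_addEquiv_of_link_eq hT A
  obtain ⟨g₂⟩ := ClassicalLink.nonempty_dehnColorings_torusSum_addEquiv (A := A) ks
  -- Of the two factors `A` on the side of `D`, one comes from a component of the shaded graph and
  -- the other from `φ_0 = 0`. They are matched with the two free colors at the last maximum of the
  -- connected sum.
  exact ⟨(f₁.trans ((AddEquiv.refl A).prodCongr (f₂.trans (f₃.trans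
    ((AddEquiv.refl A).prodCongr f₄.symm))))).trans
    ((AddEquiv.prodAssoc.symm.trans AddEquiv.prodComm).trans (g₁.trans g₂).symm)⟩
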